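/- Let $d\in\mathbb N$, $\Delta^o=\{1,\dots,d\}$, and let $\mathcal P(\Delta^o)$ be the space of probability measures on $\Delta^o$ with the weak topology. Let $A$ be a $d\times d$ stochastic matrix with $A_{x,y}>0$ for all $x,y$, and for $m\in\mathcal P(\Delta^o)$ let $mA\in\mathcal P(\Delta^o)$ be given by $(mA)(y)=\sum_x m(x)A_{x,y}$. Fix $x_0\in\Delta^o$ and let $\{X_n\}_{n\ge 0}$ be $\Delta^o$-valued random variables on a probability space with $X_0=x_0$ and, for all $n\ge 0$ and $y\in\Delta^o$, $$P(X_{n+1}=y\mid X_0,\dots,X_n)=(L^{n+1}A)(y)\ \text{ a.s.},\qquad L^{n+1}=\frac1{n+1}\sum_{i=0}^{n}\delta_{X_i}.$$ For $m\in\mathcal P(\Delta^o)$ let $\mathcal U(m)$ be the set of measurable maps $\eta:[0,\infty)\to\mathcal P(\Delta^o)$ for which the unique continuous solution $M:[0,\infty)\to\mathbb R^d$ of $$M(t)=m-\int_0^t\eta(s)\,ds+\int_0^tM(s)\,ds,\qquad t\ge 0,$$ satisfies $M(t)\in\mathcal P(\Delta^o)$ for all $t\ge0$, and put $$I(m)=\inf_{\eta\in\mathcal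 U(m)}\int_0^\infty e^{-s}R\bigl(\eta(s)\,\|\,M(s)A\bigr)\,ds,$$ where $R(\nu\|\mu)$ denotes relative entropy. Then $I(m)<\infty$ for every $m\in\mathcal P(\Delta^o)$, the sublevel set $\{m: I(m)\le k\}$ is compact for every $k\in[0,\infty)$, and $\{L^{n+1}\}_{n\ge1}$ satisfies the large deviation principle with rate function $I$ and speed $n$: for each closed $F\subseteq\mathcal P(\Delta^o)$, $$\limsup_{n\to\infty}\frac1n\log P(L^{n+1}\in F)\le-\inf_{m\in F}I(m),$$ and for each open $G\subseteq\mathcal P(\Delta^o)$, $$\liminf_{n\to\infty}\frac1n\log P(L^{n+1}\in G)\ge-\inf_{m\in G}I(m),$$ with the conventions $\log0=-\infty$ and $\inf\emptyset=+\infty$. -/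

import Mathlib

open Set Filter Topology MeasureTheory ProbabilityTheory InformationTheory
open scoped ENNReal NNReal

noncomputable section

namespace ReinforcedChain

/-- A rate function on `S`: a `[0,∞]`-valued function all of whose sublevel sets at finite levels
are compact. -/
def IsRateFunction {S : Type*} [TopologicalSpace S] (I : S → ℝ≥0∞) : Prop :=
  ∀ k : ℝ≥0, IsCompact {m : S | I m ≤ k}

/-- The large deviation principle, with speed `n`, for a sequence of `S`-valued random elements:
the upper bound for closed sets and the lower bound for open sets. Logarithms and infima are taken
in the extended reals, with `log 0 = -∞` and `inf ∅ = +∞`. -/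
def SatisfiesLDP {S Ω : Type*} [TopologicalSpace S] [MeasurableSpace Ω] (P : Measure Ω)
    (Y : ℕ → Ω → S) (I : S → ℝ≥0∞) : Prop :=
  (∀ F : Set S, IsClosed F →
    limsup (fun n : ℕ => ENNReal.log (P {ω | Y n ω ∈ F}) / (n : EReal)) atTop
      ≤ -((⨅ m ∈ F, I m : ℝ≥0∞) : EReal)) ∧
  (∀ G : Set S, IsOpen G →
    -((⨅ m ∈ G, I m : ℝ≥0∞) : EReal)
      ≤ liminf (fun n : ℕ => ENNReal.log (P {ω | Y n ω ∈ G}) / (n : EReal)) atTop)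

/-- The empirical measure `L^{n+1} = (n+1)⁻¹ ∑_{i=0}^{n} δ_{x i}` of the first `n + 1` states of a
sequence `x`, with the weak topology on probability measures. -/
def empiricalMeasure {d : ℕ} (x : ℕ → Fin d) (n : ℕ) : ProbabilityMeasure (Fin d) :=
  ⟨((n + 1 : ℕ) : ℝ≥0∞)⁻¹ • ∑ i ∈ Finset.range (n + 1), Measure.dirac (x i), ⟨by
    rw [Measure.smul_apply, Measure.finsetSum_apply]
    simp only [measure_univ, Finset.sum_const, Finset.card_range, nsmul_eq_mul, mul_one,
      smul_eq_mul]
    exact ENNReal.inv_mul_cancel (by simp) (ENNReal.natCast_ne_top _)⟩⟩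

/-- The mass that a probability measure on `Fin d` gives to the point `x`. -/
def mass {d : ℕ} (m : ProbabilityMeasure (Fin d)) (x : Fin d) : ℝ :=
  (m : Measure (Fin d)).real {x}

/-- The measure `mA`, which gives the mass `∑ x, m(x) A(x,y)` to the point `y`. -/
def nextLaw {d : ℕ} (A : Matrix (Fin d) (Fin d) ℝ) (m : ProbabilityMeasure (Fin d)) :
    Measure (Fin d) :=
  ∑ y : Fin d, ENNReal.ofReal (∑ x : Fin d, mass m x * A x y) • Measure.dirac y

/-- `X` is a reinforced chain with transition matrix `A` started at `x₀`: given `X_0, …, X_n`,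
the law of `X_{n+1}` is `L^{n+1} A`. -/
structure IsReinforcedChain {d : ℕ} {Ω : Type*} [MeasurableSpace Ω] (P : Measure Ω)
    (A : Matrix (Fin d) (Fin d) ℝ) (x₀ : Fin d) (X : ℕ → Ω → Fin d) : Prop where
  measurable : ∀ n, Measurable (X n)
  init : ∀ ω, X 0 ω = x₀
  step : ∀ (n : ℕ) (y : Fin d),
    P[(X (n + 1) ⁻¹' {y}).indicator (fun _ => (1 : ℝ)) |
        ⨆ k ≤ n, MeasurableSpace.comap (X k) inferInstance]
      =ᵐ[P] fun ω => (nextLaw A (empiricalMeasure (fun i => X i ω) n)).real {y}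

/-- `M` is a continuous path of probability measures on the time axis `[0,∞)` with
`M(t) = m - ∫_0^t η(s) ds + ∫_0^t M(s) ds` for all `t ≥ 0` (an identity of vectors).
Paths are functions on `ℝ` of which only the restrictions to `[0,∞)` matter. -/
structure Solves {d : ℕ} (m : ProbabilityMeasure (Fin d))
    (η M : ℝ → ProbabilityMeasure (Fin d)) : Prop where
  continuousOn : ContinuousOn M (Ici 0)
  dynamics : ∀ t : ℝ, 0 ≤ t → ∀ x : Fin d,
    mass (M t) x = mass m x - (∫ s in (0 : ℝ)..t, mass (η s) x) + ∫ s in (0 : ℝ)..t, mass (M s) x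

/-- The admissible controls `𝒰(m)`: the measurable paths `η` for which the solution of the linear
dynamics started at `m` stays in the set of probability measures. -/
def controls {d : ℕ} (m : ProbabilityMeasure (Fin d)) :
    Set (ℝ → ProbabilityMeasure (Fin d)) :=
  {η | Measurable η ∧ ∃ M, Solves m η M}

/-- The discounted cost `∫_0^∞ e^{-s} R(η(s) ‖ M(s)A) ds`. -/
def cost {d : ℕ} (A : Matrix (Fin d) (Fin d) ℝ) (η M : ℝ → ProbabilityMeasure (Fin d)) : ℝ≥0∞ :=
  ∫⁻ s in Ioi (0 : ℝ),
    ENNReal.ofReal (Real.exp (-s)) * klDiv (η s : Measure (Fin d)) (nextLaw A (M s))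

/-- The value `I(m)` of the discounted control problem. The solution `M` is determined by `m` and
`η` on `[0,∞)`, so the inner infimum is over one cost only. -/
def rate {d : ℕ} (A : Matrix (Fin d) (Fin d) ℝ) (m : ProbabilityMeasure (Fin d)) : ℝ≥0∞ :=
  ⨅ η ∈ controls m, ⨅ M, ⨅ _ : Solves m η M, cost A η M

end ReinforcedChain

end

noncomputable section

namespace ReinforcedChain

open scoped Matrix

variable {d : ℕ}

/-! ### Probability vectors and probability measures on `Fin d` -/

lemma mass_nonneg (m : ProbabilityMeasure (Fin d)) (x : Fin d) : 0 ≤ mass m x :=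
  measureReal_nonneg

lemma mass_mem_stdSimplex (m : ProbabilityMeasure (Fin d)) : mass m ∈ stdSimplex ℝ (Fin d) := by
  refine ⟨mass_nonneg m, ?_⟩
  have := sum_measureReal_singleton (μ := (m : Measure (Fin d))) Finset.univ
  simpa [mass] using this

/-- The finite measure on `Fin d` with given weights. -/
def weightedDirac (w : Fin d → ℝ) : Measure (Fin d) :=
  ∑ y : Fin d, ENNReal.ofReal (w y) • Measure.dirac y

lemma weightedDirac_singleton (w : Fin d → ℝ) (x : Fin d) :
    weightedDirac w {x} = ENNReal.ofReal (w x) := by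
  simp only [weightedDirac, Measure.finsetSum_apply, Measure.smul_apply, smul_eq_mul]
  rw [Finset.sum_eq_single x]
  · simp
  · intro y _ hy
    simp [hy]
  · simp

lemma weightedDirac_univ {w : Fin d → ℝ} (hw : ∀ x, 0 ≤ w x) :
    weightedDirac w univ = ENNReal.ofReal (∑ x, w x) := by
  simp [weightedDirac, Measure.finsetSum_apply, ENNReal.ofReal_sum_of_nonneg (fun x _ => hw x)]

lemma nextLaw_eq (A : Matrix (Fin d) (Fin d) ℝ) (m : ProbabilityMeasure (Fin d)) :
    nextLaw A m = weightedDirac (mass m ᵥ* A) := rfl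

/-- The probability measure with given weights. -/
def ofVec (v : Fin d → ℝ) (hv : v ∈ stdSimplex ℝ (Fin d)) : ProbabilityMeasure (Fin d) :=
  ⟨weightedDirac v, ⟨by rw [weightedDirac_univ hv.1, hv.2, ENNReal.ofReal_one]⟩⟩

@[simp]
lemma mass_ofVec (v : Fin d → ℝ) (hv : v ∈ stdSimplex ℝ (Fin d)) : mass (ofVec v hv) = v := by
  ext x
  simp only [mass, ofVec, ProbabilityMeasure.coe_mk, Measure.real, weightedDirac_singleton]
  exact ENNReal.toReal_ofReal (hv.1 x)

lemma mass_injective : Function.Injective (mass : ProbabilityMeasure (Fin d) → Fin d → ℝ) := by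
  intro m m' h
  apply Subtype.ext
  refine Measure.ext_of_singleton fun x => ?_
  have := congrFun h x
  simp only [mass, Measure.real] at this
  exact (ENNReal.toReal_eq_toReal_iff' (measure_ne_top (m : Measure (Fin d)) _)
    (measure_ne_top (m' : Measure (Fin d)) _)).1 this

lemma continuous_mass : Continuous (mass : ProbabilityMeasure (Fin d) → Fin d → ℝ) := by
  refine continuous_pi fun x => ?_
  let f : C(Fin d, ℝ) := ⟨Pi.single x 1, continuous_of_discreteTopology⟩
  have h := ProbabilityMeasure.continuous_integral_continuousMap (X := Fin d) f
  refine h.congr fun m => ?_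
  rw [integral_fintype (Integrable.of_finite)]
  simp [f, mass, Pi.single_apply]

lemma isClosedEmbedding_mass :
    IsClosedEmbedding (mass : ProbabilityMeasure (Fin d) → Fin d → ℝ) :=
  continuous_mass.isClosedEmbedding mass_injective

lemma measurable_mass (x : Fin d) :
    Measurable fun m : ProbabilityMeasure (Fin d) => mass m x :=
  ((Measure.measurable_coe (measurableSet_singleton x)).comp
    measurable_subtype_coe).ennreal_toReal

/-! ### Relative entropy of vectors -/

/-- A stochastic matrix all of whose entries are at least `δ > 0`. -/
structure IsStochasticGe (A : Matrix (Fin d) (Fin d) ℝ) (δ : ℝ) : Prop where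
  mem : A ∈ Matrix.rowStochastic ℝ (Fin d)
  pos : 0 < δ
  le : ∀ x y, δ ≤ A x y

lemma exists_isStochasticGe {A : Matrix (Fin d) (Fin d) ℝ}
    (hA : A ∈ Matrix.rowStochastic ℝ (Fin d)) (hpos : ∀ x y, 0 < A x y) :
    ∃ δ, IsStochasticGe A δ := by
  rcases isEmpty_or_nonempty (Fin d) with h | h
  · exact ⟨1, hA, one_pos, fun x => h.elim x⟩
  · obtain ⟨p, hp⟩ := Finite.exists_min fun p : Fin d × Fin d => A p.1 p.2
    exact ⟨A p.1 p.2, hA, hpos _ _, fun x y => hp (x, y)⟩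

namespace IsStochasticGe

variable {A : Matrix (Fin d) (Fin d) ℝ} {δ : ℝ} {v w : Fin d → ℝ}

lemma le_vecMul (hA : IsStochasticGe A δ) (hv : v ∈ stdSimplex ℝ (Fin d)) (y : Fin d) :
    δ ≤ (v ᵥ* A) y := by
  calc δ = ∑ x, v x * δ := by rw [← Finset.sum_mul, hv.2, one_mul]
    _ ≤ ∑ x, v x * A x y :=
      Finset.sum_le_sum fun x _ => mul_le_mul_of_nonneg_left (hA.le x y) (hv.1 x)

lemma vecMul_pos (hA : IsStochasticGe A δ) (hv : v ∈ stdSimplex ℝ (Fin d)) (y : Fin d) :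
    0 < (v ᵥ* A) y := hA.pos.trans_le (hA.le_vecMul hv y)

lemma vecMul_mem (hA : IsStochasticGe A δ) (hv : v ∈ stdSimplex ℝ (Fin d)) :
    v ᵥ* A ∈ stdSimplex ℝ (Fin d) := by
  refine ⟨fun y => (hA.vecMul_pos hv y).le, ?_⟩
  calc ∑ y, ∑ x, v x * A x y = ∑ x, v x * ∑ y, A x y := by
        rw [Finset.sum_comm]; simp [Finset.mul_sum]
    _ = 1 := by simp [Matrix.sum_row_of_mem_rowStochastic hA.mem, hv.2]

lemma vecMul_le_one (hA : IsStochasticGe A δ) (hv : v ∈ stdSimplex ℝ (Fin d)) (y : Fin d) :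
    (v ᵥ* A) y ≤ 1 :=
  (mem_Icc_of_mem_stdSimplex (hA.vecMul_mem hv) y).2

lemma neg_log_vecMul_le (hA : IsStochasticGe A δ) (hv : v ∈ stdSimplex ℝ (Fin d)) (y : Fin d) :
    -Real.log ((v ᵥ* A) y) ≤ δ⁻¹ := by
  have h1 : Real.log δ ≤ Real.log ((v ᵥ* A) y) := Real.log_le_log hA.pos (hA.le_vecMul hv y)
  have h2 := Real.log_le_sub_one_of_pos (inv_pos.2 hA.pos)
  rw [Real.log_inv] at h2
  linarith

lemma log_vecMul_nonpos (hA : IsStochasticGe A δ) (hv : v ∈ stdSimplex ℝ (Fin d)) (y : Fin d) :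
    Real.log ((v ᵥ* A) y) ≤ 0 :=
  Real.log_nonpos (hA.vecMul_pos hv y).le (hA.vecMul_le_one hv y)

lemma log_vecMul_sub_le (hA : IsStochasticGe A δ) (hv : v ∈ stdSimplex ℝ (Fin d))
    (hw : w ∈ stdSimplex ℝ (Fin d)) (y : Fin d) :
    Real.log ((v ᵥ* A) y) - Real.log ((w ᵥ* A) y) ≤ δ⁻¹ * ∑ x, |v x - w x| := by
  have hv' := hA.vecMul_pos hv y
  have hw' := hA.vecMul_pos hw y
  rw [← Real.log_div hv'.ne' hw'.ne']
  have h1 := Real.log_le_sub_one_of_pos (div_pos hv' hw')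
  have h2 : (v ᵥ* A) y / (w ᵥ* A) y - 1 = ((v ᵥ* A) y - (w ᵥ* A) y) / (w ᵥ* A) y := by
    field_simp
  have h3 : (v ᵥ* A) y - (w ᵥ* A) y ≤ ∑ x, |v x - w x| := by
    have : (v ᵥ* A) y - (w ᵥ* A) y = ∑ x, (v x - w x) * A x y := by
      simp [Matrix.vecMul, dotProduct, sub_mul]
    rw [this]
    refine Finset.sum_le_sum fun x _ => ?_
    calc (v x - w x) * A x y ≤ |v x - w x| * A x y :=
          mul_le_mul_of_nonneg_right (le_abs_self _) (hA.pos.le.trans (hA.le x y))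
      _ ≤ |v x - w x| * 1 := mul_le_mul_of_nonneg_left
          (Matrix.le_one_of_mem_rowStochastic hA.mem) (abs_nonneg _)
      _ = _ := mul_one _
  refine h1.trans ?_
  rw [h2, div_le_iff₀ hw', mul_comm δ⁻¹, mul_assoc]
  have h4 : 1 ≤ δ⁻¹ * (w ᵥ* A) y := by
    rw [inv_mul_eq_div, le_div_iff₀ hA.pos, one_mul]
    exact hA.le_vecMul hw y
  have h5 : 0 ≤ ∑ x, |v x - w x| := Finset.sum_nonneg fun x _ => abs_nonneg _
  nlinarith

end IsStochasticGe

/-- Relative entropy of a probability vector with respect to a positive probability vector. -/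
def relEnt (p q : Fin d → ℝ) : ℝ := ∑ y, (p y * Real.log (p y) - p y * Real.log (q y))

section

variable {A : Matrix (Fin d) (Fin d) ℝ} {δ : ℝ} {p v w : Fin d → ℝ}

lemma relEnt_nonneg {q : Fin d → ℝ} (hp : p ∈ stdSimplex ℝ (Fin d))
    (hq : q ∈ stdSimplex ℝ (Fin d)) (hq0 : ∀ y, 0 < q y) : 0 ≤ relEnt p q := by
  have : ∑ y, (p y - q y) ≤ relEnt p q := by
    refine Finset.sum_le_sum fun y _ => ?_
    rcases (hp.1 y).eq_or_lt with h | h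
    · simp [← h, (hq0 y).le]
    · have h1 := Real.log_le_sub_one_of_pos (div_pos (hq0 y) h)
      rw [Real.log_div (hq0 y).ne' h.ne'] at h1
      have h2 := mul_le_mul_of_nonneg_left h1 h.le
      have h3 : p y * (q y / p y - 1) = q y - p y := by field_simp
      nlinarith
  simpa [hp.2, hq.2] using this

lemma relEnt_vecMul_nonneg (hA : IsStochasticGe A δ) (hp : p ∈ stdSimplex ℝ (Fin d))
    (hv : v ∈ stdSimplex ℝ (Fin d)) : 0 ≤ relEnt p (v ᵥ* A) :=
  relEnt_nonneg hp (hA.vecMul_mem hv) (hA.vecMul_pos hv)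

lemma relEnt_vecMul_le (hA : IsStochasticGe A δ) (hp : p ∈ stdSimplex ℝ (Fin d))
    (hv : v ∈ stdSimplex ℝ (Fin d)) : relEnt p (v ᵥ* A) ≤ δ⁻¹ := by
  calc relEnt p (v ᵥ* A) ≤ ∑ y, p y * δ⁻¹ := by
        refine Finset.sum_le_sum fun y _ => ?_
        have h1 := mem_Icc_of_mem_stdSimplex hp y
        have h2 := mul_nonpos_of_nonneg_of_nonpos h1.1 (Real.log_nonpos h1.1 h1.2)
        have h3 := mul_le_mul_of_nonneg_left (hA.neg_log_vecMul_le hv y) h1.1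
        linarith
    _ = δ⁻¹ := by rw [← Finset.sum_mul, hp.2, one_mul]

lemma relEnt_vecMul_le_add (hA : IsStochasticGe A δ) (hp : p ∈ stdSimplex ℝ (Fin d))
    (hv : v ∈ stdSimplex ℝ (Fin d)) (hw : w ∈ stdSimplex ℝ (Fin d)) :
    relEnt p (v ᵥ* A) ≤ relEnt p (w ᵥ* A) + δ⁻¹ * ∑ x, |v x - w x| := by
  have : relEnt p (v ᵥ* A) - relEnt p (w ᵥ* A) ≤ ∑ y, p y * (δ⁻¹ * ∑ x, |v x - w x|) := by
    rw [relEnt, relEnt, ← Finset.sum_sub_distrib]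
    refine Finset.sum_le_sum fun y _ => ?_
    have := mul_le_mul_of_nonneg_left (hA.log_vecMul_sub_le hw hv y) (hp.1 y)
    simp only [abs_sub_comm (w _)] at this
    linarith
  rw [← Finset.sum_mul, hp.2, one_mul] at this
  linarith

lemma klDiv_eq_relEnt (m : ProbabilityMeasure (Fin d)) {q : Fin d → ℝ}
    (hq : q ∈ stdSimplex ℝ (Fin d)) (hq0 : ∀ y, 0 < q y) :
    klDiv (m : Measure (Fin d)) (weightedDirac q) = ENNReal.ofReal (relEnt (mass m) q) := by
  have hprob : IsProbabilityMeasure (weightedDirac q) := (ofVec q hq).2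
  have hac : (m : Measure (Fin d)) ≪ weightedDirac q := by
    intro s hs
    have : s = ∅ := by
      by_contra hne
      obtain ⟨y, hy⟩ := nonempty_iff_ne_empty.2 hne
      have h1 := measure_mono_null (singleton_subset_iff.2 hy) hs
      rw [weightedDirac_singleton, ENNReal.ofReal_eq_zero] at h1
      exact (hq0 y).not_ge h1
    simp [this]
  rw [klDiv_of_ac_of_integrable hac Integrable.of_finite]
  simp only [probReal_univ, add_sub_cancel_right]
  congr 1
  rw [integral_fintype Integrable.of_finite, relEnt]
  refine Finset.sum_congr rfl fun y _ => ?_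
  change mass m y • _ = _
  rcases (mass_nonneg m y).eq_or_lt with h | h
  · simp [← h]
  have h1 : (Measure.rnDeriv (m : Measure (Fin d)) (weightedDirac q) y).toReal = mass m y / q y := by
    have h2 := Measure.setLIntegral_rnDeriv hac {y}
    rw [lintegral_singleton, weightedDirac_singleton] at h2
    have h3 := congrArg ENNReal.toReal h2
    rw [ENNReal.toReal_mul, ENNReal.toReal_ofReal (hq0 y).le] at h3
    rw [eq_div_iff (hq0 y).ne', h3]
    rfl
  rw [llr, h1, Real.log_div h.ne' (hq0 y).ne', smul_eq_mul]
  ring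

lemma klDiv_nextLaw (hA : IsStochasticGe A δ) (m m' : ProbabilityMeasure (Fin d)) :
    klDiv (m : Measure (Fin d)) (nextLaw A m')
      = ENNReal.ofReal (relEnt (mass m) (mass m' ᵥ* A)) := by
  rw [nextLaw_eq]
  exact klDiv_eq_relEnt m (hA.vecMul_mem (mass_mem_stdSimplex m'))
    (hA.vecMul_pos (mass_mem_stdSimplex m'))

end

/-! ### Running averages of sequences of vectors -/

/-- The average of the first `k` terms. -/
def avg (η : ℕ → Fin d → ℝ) (k : ℕ) : Fin d → ℝ := fun x => (k : ℝ)⁻¹ * ∑ i ∈ Finset.range k, η i x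

lemma mul_avg (η : ℕ → Fin d → ℝ) (k : ℕ) (x : Fin d) :
    k * avg η k x = ∑ i ∈ Finset.range k, η i x := by
  rcases k.eq_zero_or_pos with rfl | hk
  · simp
  · have : (k : ℝ) ≠ 0 := by positivity
    simp [avg, this]

lemma avg_mem_stdSimplex {η : ℕ → Fin d → ℝ} (hη : ∀ i, η i ∈ stdSimplex ℝ (Fin d)) {k : ℕ}
    (hk : 0 < k) : avg η k ∈ stdSimplex ℝ (Fin d) := by
  refine ⟨fun x => mul_nonneg (by positivity) (Finset.sum_nonneg fun i _ => (hη i).1 x), ?_⟩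
  simp only [avg]
  rw [← Finset.mul_sum, Finset.sum_comm, Finset.sum_congr rfl fun i _ => (hη i).2]
  have : (k : ℝ) ≠ 0 := by positivity
  simp [this]

lemma sum_abs_sub_le_two {v w : Fin d → ℝ} (hv : v ∈ stdSimplex ℝ (Fin d))
    (hw : w ∈ stdSimplex ℝ (Fin d)) : ∑ x, |v x - w x| ≤ 2 := by
  calc ∑ x, |v x - w x| ≤ ∑ x, (v x + w x) := Finset.sum_le_sum fun x _ => by
        rw [abs_le]; constructor <;> linarith [hv.1 x, hw.1 x]
    _ = 2 := by rw [Finset.sum_add_distrib, hv.2, hw.2]; norm_num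

/-- The total relative entropy cost of a sequence of `n + 1` steps; the first step is free. -/
def seqCost (A : Matrix (Fin d) (Fin d) ℝ) (n : ℕ) (η : ℕ → Fin d → ℝ) : ℝ :=
  ∑ j ∈ Finset.range n, relEnt (η (j + 1)) (avg η (j + 1) ᵥ* A)

/-! ### The controlled dynamics -/

section Dynamics

lemma exp_mul_intervalIntegral {h : ℝ → ℝ} {t : ℝ} (hh : IntervalIntegrable h volume 0 t)
    (c : ℝ) :
    ∫ s in (0 : ℝ)..t, (c * Real.exp (c * s) * (∫ r in (0 : ℝ)..s, h r) + Real.exp (c * s) * h s)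
      = Real.exp (c * t) * ∫ s in (0 : ℝ)..t, h s := by
  have hderiv : ∀ s, HasDerivAt (fun s => Real.exp (c * s)) (c * Real.exp (c * s)) s := fun s => by
    simpa [mul_comm] using ((hasDerivAt_id s).const_mul c).exp
  have hac : AbsolutelyContinuousOnInterval (fun s => Real.exp (c * s)) 0 t :=
    ContDiffOn.absolutelyContinuousOnInterval (by fun_prop)
  have hac' := hh.absolutelyContinuousOnInterval_intervalIntegral (c := 0) (by simp)
  have key := hac.integral_deriv_mul_eq_sub hac'
  simp only [intervalIntegral.integral_same, mul_zero, sub_zero] at key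
  rw [← key]
  refine intervalIntegral.integral_congr_ae ?_
  filter_upwards [hh.ae_hasDerivAt_integral] with s hs hst
  have h1 := hs (uIoc_subset_uIcc hst) 0 (by simp)
  rw [h1.deriv, (hderiv s).deriv]

variable {m : ProbabilityMeasure (Fin d)} {η M : ℝ → ProbabilityMeasure (Fin d)}

lemma mass_le_one (m : ProbabilityMeasure (Fin d)) (x : Fin d) : mass m x ≤ 1 :=
  (mem_Icc_of_mem_stdSimplex (mass_mem_stdSimplex m) x).2

lemma abs_mass_le_one (m : ProbabilityMeasure (Fin d)) (x : Fin d) : |mass m x| ≤ 1 := by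
  rw [abs_of_nonneg (mass_nonneg m x)]
  exact mass_le_one m x

lemma measurable_mass_comp (hη : Measurable η) (x : Fin d) : Measurable fun s => mass (η s) x :=
  (measurable_mass x).comp hη

lemma intervalIntegrable_mass (hη : Measurable η) (x : Fin d) (a b : ℝ) :
    IntervalIntegrable (fun s => mass (η s) x) volume a b :=
  (intervalIntegrable_const (c := (1 : ℝ))).mono_fun
    (measurable_mass_comp hη x).aestronglyMeasurable
    (Eventually.of_forall fun s => by simpa using abs_mass_le_one (η s) x)

lemma integrableOn_exp_neg_mul {f : ℝ → ℝ} {C t : ℝ}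
    (hf : AEStronglyMeasurable f (volume.restrict (Ioi t))) (hC : ∀ s ∈ Ioi t, |f s| ≤ C) :
    IntegrableOn (fun s => Real.exp (-s) * f s) (Ioi t) := by
  have hexp : AEStronglyMeasurable (fun s : ℝ => Real.exp (-s)) (volume.restrict (Ioi t)) :=
    Continuous.aestronglyMeasurable (by fun_prop)
  refine Integrable.mono' ((integrableOn_exp_neg_Ioi t).mul_const C) (hexp.mul hf) ?_
  filter_upwards [ae_restrict_mem measurableSet_Ioi] with s hs
  rw [Real.norm_eq_abs, abs_mul, abs_of_pos (Real.exp_pos _)]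
  exact mul_le_mul_of_nonneg_left (hC s hs) (Real.exp_pos _).le

lemma integrableOn_exp_neg_mul_mass (hη : Measurable η) (x : Fin d) (t : ℝ) :
    IntegrableOn (fun s => Real.exp (-s) * mass (η s) x) (Ioi t) :=
  integrableOn_exp_neg_mul (measurable_mass_comp hη x).aestronglyMeasurable
    fun s _ => abs_mass_le_one (η s) x

lemma Solves.continuousOn_mass (h : Solves m η M) (x : Fin d) :
    ContinuousOn (fun s => mass (M s) x) (Ici 0) :=
  ((continuous_apply x).comp continuous_mass).comp_continuousOn h.continuousOn

lemma Solves.intervalIntegrable (h : Solves m η M) (x : Fin d) {a b : ℝ} (ha : 0 ≤ a)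
    (hb : 0 ≤ b) : IntervalIntegrable (fun s => mass (M s) x) volume a b :=
  ((h.continuousOn_mass x).mono fun s hs => by
    rcases mem_uIcc.1 hs with h | h
    · exact ha.trans h.1
    · exact hb.trans h.1).intervalIntegrable

lemma Solves.mass_sub (hη : Measurable η) (h : Solves m η M) (x : Fin d) {t : ℝ} (ht : 0 ≤ t) :
    mass (M t) x = mass m x + ∫ s in (0 : ℝ)..t, (mass (M s) x - mass (η s) x) := by
  rw [h.dynamics t ht x, intervalIntegral.integral_sub (h.intervalIntegrable x le_rfl ht)
    (intervalIntegrable_mass hη x 0 t)]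
  ring

lemma Solves.exp_neg_mul_mass_eq (hη : Measurable η) (h : Solves m η M) (x : Fin d) {t : ℝ}
    (ht : 0 ≤ t) :
    Real.exp (-t) * mass (M t) x
      = mass m x - ∫ s in (0 : ℝ)..t, Real.exp (-s) * mass (η s) x := by
  have hint : IntervalIntegrable (fun s => mass (M s) x - mass (η s) x) volume 0 t :=
    (h.intervalIntegrable x le_rfl ht).sub (intervalIntegrable_mass hη x 0 t)
  have key := exp_mul_intervalIntegral hint (-1)
  have h1 : ∫ s in (0 : ℝ)..t, (-1 * Real.exp (-1 * s)
        * (∫ r in (0 : ℝ)..s, (mass (M r) x - mass (η r) x))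
          + Real.exp (-1 * s) * (mass (M s) x - mass (η s) x))
      = ∫ s in (0 : ℝ)..t, (Real.exp (-s) * mass m x - Real.exp (-s) * mass (η s) x) := by
    refine intervalIntegral.integral_congr fun s hs => ?_
    rw [uIcc_of_le ht] at hs
    have := h.mass_sub hη x hs.1
    have h2 : ∫ r in (0 : ℝ)..s, (mass (M r) x - mass (η r) x) = mass (M s) x - mass m x := by
      linarith
    simp only [h2, neg_mul, one_mul]
    ring
  have h3 : ∫ s in (0 : ℝ)..t, Real.exp (-s) * mass m x = (1 - Real.exp (-t)) * mass m x := by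
    rw [intervalIntegral.integral_mul_const]
    simp
  have h4 : ∫ r in (0 : ℝ)..t, (mass (M r) x - mass (η r) x) = mass (M t) x - mass m x := by
    have := h.mass_sub hη x ht
    linarith
  rw [h1, intervalIntegral.integral_sub, h3, h4] at key
  · simp only [neg_mul, one_mul] at key
    linarith
  · exact (Continuous.intervalIntegrable (by fun_prop) _ _)
  · exact (intervalIntegrable_mass hη x 0 t).continuousOn_mul
      (Continuous.continuousOn (by fun_prop))

lemma Solves.mass_eq_integral (hη : Measurable η) (h : Solves m η M) (x : Fin d) :
    mass m x = ∫ s in Ioi (0 : ℝ), Real.exp (-s) * mass (η s) x := by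
  have h1 := intervalIntegral_tendsto_integral_Ioi 0 (integrableOn_exp_neg_mul_mass hη x 0)
    tendsto_id
  have h2 : Tendsto (fun t => Real.exp (-t) * mass (M t) x) atTop (𝓝 0) := by
    refine squeeze_zero (fun t => mul_nonneg (Real.exp_pos _).le (mass_nonneg _ _))
      (fun t => mul_le_of_le_one_right (Real.exp_pos _).le (mass_le_one _ _))
      (Real.tendsto_exp_neg_atTop_nhds_zero)
  have h3 : Tendsto (fun t => mass m x - Real.exp (-t) * mass (M t) x) atTop (𝓝 (mass m x)) := by
    simpa using tendsto_const_nhds.sub h2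
  refine tendsto_nhds_unique h3 (h1.congr' ?_)
  filter_upwards [eventually_ge_atTop 0] with t ht
  rw [h.exp_neg_mul_mass_eq hη x ht]
  simp

lemma integral_Ioi_sub (hη : Measurable η) (x : Fin d) (t : ℝ) :
    (∫ s in Ioi (0 : ℝ), Real.exp (-s) * mass (η s) x)
      - ∫ s in (0 : ℝ)..t, Real.exp (-s) * mass (η s) x
      = ∫ s in Ioi t, Real.exp (-s) * mass (η s) x := by
  have := intervalIntegral.integral_interval_add_Ioi (integrableOn_exp_neg_mul_mass hη x 0)
    (integrableOn_exp_neg_mul_mass hη x t)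
  linarith

lemma Solves.exp_neg_mul_mass (hη : Measurable η) (h : Solves m η M) (x : Fin d) {t : ℝ}
    (ht : 0 ≤ t) :
    Real.exp (-t) * mass (M t) x = ∫ s in Ioi t, Real.exp (-s) * mass (η s) x := by
  rw [h.exp_neg_mul_mass_eq hη x ht, h.mass_eq_integral hη x, integral_Ioi_sub hη]

lemma exists_solves (hη : Measurable η)
    (hm : ∀ x, mass m x = ∫ s in Ioi (0 : ℝ), Real.exp (-s) * mass (η s) x) :
    ∃ M, Solves m η M := by
  have hmem : ∀ t : ℝ, (fun x => Real.exp t * ∫ s in Ioi t, Real.exp (-s) * mass (η s) x)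
      ∈ stdSimplex ℝ (Fin d) := by
    refine fun t => ⟨fun x => mul_nonneg (Real.exp_pos _).le <|
      integral_nonneg fun s => mul_nonneg (Real.exp_pos _).le (mass_nonneg _ _), ?_⟩
    rw [← Finset.mul_sum, ← integral_finsetSum _ fun x _ => integrableOn_exp_neg_mul_mass hη x t]
    simp only [← Finset.mul_sum, (mass_mem_stdSimplex _).2, mul_one]
    rw [integral_exp_neg_Ioi, ← Real.exp_add]
    simp
  have hG : ∀ x t, Real.exp t * ∫ s in Ioi t, Real.exp (-s) * mass (η s) x
      = Real.exp t * (mass m x - ∫ s in (0 : ℝ)..t, Real.exp (-s) * mass (η s) x) := by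
    intro x t
    rw [hm, integral_Ioi_sub hη]
  have hint : ∀ x a b, IntervalIntegrable (fun s => Real.exp (-s) * mass (η s) x) volume a b :=
    fun x a b => (intervalIntegrable_mass hη x a b).continuousOn_mul
      (Continuous.continuousOn (by fun_prop))
  have hcont : ∀ x, Continuous fun t => ∫ s in (0 : ℝ)..t, Real.exp (-s) * mass (η s) x :=
    fun x => intervalIntegral.continuous_primitive (fun a b => hint x a b) 0
  refine ⟨fun t => ofVec _ (hmem t), ?_, ?_⟩
  · rw [isClosedEmbedding_mass.isInducing.continuousOn_iff]
    refine continuousOn_pi.2 fun x => Continuous.continuousOn ?_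
    simp only [Function.comp_def, mass_ofVec, hG]
    exact Real.continuous_exp.mul (continuous_const.sub (hcont x))
  · intro t _ x
    simp only [mass_ofVec, hG]
    have key := exp_mul_intervalIntegral (hint x 0 t) 1
    simp only [one_mul] at key
    have h2 : ∀ s, Real.exp s * (Real.exp (-s) * mass (η s) x) = mass (η s) x := fun s => by
      rw [← mul_assoc, ← Real.exp_add]; simp
    simp only [h2] at key
    have hc : IntervalIntegrable (fun s => Real.exp s
        * ∫ r in (0 : ℝ)..s, Real.exp (-r) * mass (η r) x) volume 0 t :=
      (Real.continuous_exp.mul (hcont x)).intervalIntegrable 0 t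
    rw [intervalIntegral.integral_add hc (intervalIntegrable_mass hη x 0 t)] at key
    simp only [mul_sub]
    rw [intervalIntegral.integral_sub (Continuous.intervalIntegrable (by fun_prop) _ _) hc,
      intervalIntegral.integral_mul_const, integral_exp, Real.exp_zero]
    linarith

lemma Solves.sum_abs_mass_sub_le (hη : Measurable η) (h : Solves m η M) {s t : ℝ} (hs : 0 ≤ s)
    (hst : s ≤ t) : ∑ x, |mass (M t) x - mass (M s) x| ≤ 2 * (t - s) := by
  have ht := hs.trans hst
  have hint : ∀ x, IntervalIntegrable (fun r => mass (M r) x - mass (η r) x) volume s t :=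
    fun x => (h.intervalIntegrable x hs ht).sub (intervalIntegrable_mass hη x s t)
  have h0 : ∀ x, mass (M t) x - mass (M s) x = ∫ r in s..t, (mass (M r) x - mass (η r) x) := by
    intro x
    rw [h.mass_sub hη x hs, h.mass_sub hη x ht, add_sub_add_left_eq_sub]
    exact intervalIntegral.integral_interval_sub_left
      ((h.intervalIntegrable x le_rfl ht).sub (intervalIntegrable_mass hη x 0 t))
      ((h.intervalIntegrable x le_rfl hs).sub (intervalIntegrable_mass hη x 0 s))
  calc ∑ x, |mass (M t) x - mass (M s) x|
      ≤ ∑ x, ∫ r in s..t, |mass (M r) x - mass (η r) x| := by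
        refine Finset.sum_le_sum fun x _ => ?_
        rw [h0]
        exact intervalIntegral.abs_integral_le_integral_abs hst
    _ = ∫ r in s..t, ∑ x, |mass (M r) x - mass (η r) x| :=
        (intervalIntegral.integral_finsetSum fun x _ => (hint x).abs).symm
    _ ≤ ∫ _ in s..t, (2 : ℝ) := by
        refine intervalIntegral.integral_mono_on hst ?_ intervalIntegrable_const fun r _ =>
          sum_abs_sub_le_two (mass_mem_stdSimplex _) (mass_mem_stdSimplex _)
        exact (IntervalIntegrable.sum Finset.univ fun x _ => (hint x).abs).congr_ae
          (by simp [Finset.sum_fn])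
    _ = 2 * (t - s) := by simp [mul_comm]

variable {A : Matrix (Fin d) (Fin d) ℝ} {δ : ℝ}

/-- The running cost of a control. -/
def runningCost (A : Matrix (Fin d) (Fin d) ℝ) (η M : ℝ → ProbabilityMeasure (Fin d)) (s : ℝ) :
    ℝ := relEnt (mass (η s)) (mass (M s) ᵥ* A)

lemma runningCost_nonneg (hA : IsStochasticGe A δ) (s : ℝ) : 0 ≤ runningCost A η M s :=
  relEnt_vecMul_nonneg hA (mass_mem_stdSimplex _) (mass_mem_stdSimplex _)

lemma runningCost_le (hA : IsStochasticGe A δ) (s : ℝ) : runningCost A η M s ≤ δ⁻¹ :=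
  relEnt_vecMul_le hA (mass_mem_stdSimplex _) (mass_mem_stdSimplex _)

lemma abs_runningCost_le (hA : IsStochasticGe A δ) (s : ℝ) : |runningCost A η M s| ≤ δ⁻¹ := by
  rw [abs_of_nonneg (runningCost_nonneg hA s)]
  exact runningCost_le hA s

lemma Solves.aestronglyMeasurable_runningCost (hη : Measurable η) (h : Solves m η M) :
    AEStronglyMeasurable (runningCost A η M) (volume.restrict (Ioi 0)) := by
  have h1 : ∀ x, AEMeasurable (fun s => mass (M s) x) (volume.restrict (Ioi 0)) := fun x =>
    ((h.continuousOn_mass x).mono Ioi_subset_Ici_self).aemeasurable measurableSet_Ioi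
  have h2 : ∀ y, AEMeasurable (fun s => (mass (M s) ᵥ* A) y) (volume.restrict (Ioi 0)) :=
    fun y => by
      simp only [Matrix.vecMul, dotProduct]
      exact Finset.aemeasurable_fun_sum _ fun x _ => (h1 x).mul_const _
  refine AEMeasurable.aestronglyMeasurable ?_
  unfold runningCost relEnt
  refine Finset.aemeasurable_fun_sum _ fun y _ => ?_
  have h3 := (measurable_mass_comp hη y).aemeasurable (μ := volume.restrict (Ioi 0))
  exact (h3.mul h3.log).sub (h3.mul (h2 y).log)

lemma Solves.integrableOn_runningCost (hA : IsStochasticGe A δ) (hη : Measurable η)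
    (h : Solves m η M) :
    IntegrableOn (fun s => Real.exp (-s) * runningCost A η M s) (Ioi 0) :=
  integrableOn_exp_neg_mul (h.aestronglyMeasurable_runningCost hη)
    fun s _ => abs_runningCost_le hA s

lemma Solves.cost_eq (hA : IsStochasticGe A δ) (hη : Measurable η) (h : Solves m η M) :
    cost A η M
      = ENNReal.ofReal (∫ s in Ioi (0 : ℝ), Real.exp (-s) * runningCost A η M s) := by
  rw [ofReal_integral_eq_lintegral_ofReal (h.integrableOn_runningCost hA hη)
    (Eventually.of_forall fun s => mul_nonneg (Real.exp_pos _).le (runningCost_nonneg hA s)), cost]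
  refine lintegral_congr fun s => ?_
  rw [klDiv_nextLaw hA, ENNReal.ofReal_mul (Real.exp_pos _).le]
  rfl

lemma rate_le_of_solves (hA : IsStochasticGe A δ) (hη : Measurable η) (h : Solves m η M) :
    rate A m ≤ ENNReal.ofReal (∫ s in Ioi (0 : ℝ), Real.exp (-s) * runningCost A η M s) := by
  rw [← h.cost_eq hA hη]
  exact iInf₂_le_of_le η ⟨hη, M, h⟩ (iInf₂_le M h)

lemma exists_solves_of_rate_lt (hA : IsStochasticGe A δ) {c : ℝ≥0∞} (hc : rate A m < c) :
    ∃ η M, Measurable η ∧ Solves m η M ∧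
      ENNReal.ofReal (∫ s in Ioi (0 : ℝ), Real.exp (-s) * runningCost A η M s) < c := by
  simp only [rate, iInf_lt_iff] at hc
  obtain ⟨η, ⟨hη, -⟩, M, hM, hlt⟩ := hc
  exact ⟨η, M, hη, hM, by rwa [← hM.cost_eq hA hη]⟩

lemma rate_le (hA : IsStochasticGe A δ) (m : ProbabilityMeasure (Fin d)) :
    rate A m ≤ ENNReal.ofReal δ⁻¹ := by
  have h : Solves m (fun _ => m) fun _ => m :=
    ⟨continuousOn_const, fun t _ x => by simp⟩
  refine (rate_le_of_solves hA measurable_const h).trans (ENNReal.ofReal_le_ofReal ?_)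
  calc ∫ s in Ioi (0 : ℝ), Real.exp (-s) * runningCost A (fun _ => m) (fun _ => m) s
      ≤ ∫ s in Ioi (0 : ℝ), Real.exp (-s) * δ⁻¹ :=
        setIntegral_mono (h.integrableOn_runningCost hA measurable_const)
          ((integrableOn_exp_neg_Ioi 0).mul_const _)
          fun s => mul_le_mul_of_nonneg_left (runningCost_le hA s) (Real.exp_pos _).le
    _ = δ⁻¹ := by rw [integral_mul_const, integral_exp_neg_Ioi_zero, one_mul]

lemma rate_ne_top (hA : IsStochasticGe A δ) (m : ProbabilityMeasure (Fin d)) : rate A m ≠ ∞ :=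
  ((rate_le hA m).trans_lt ENNReal.ofReal_lt_top).ne

end Dynamics

/-! ### Comparison with a discrete control problem -/

section Blocks

/-- The set of times `s > 0` with `j ≤ N e^{-s} < j + 1`. -/
def timeBlock (N j : ℕ) : Set ℝ := {s | 0 < s ∧ ⌊N * Real.exp (-s)⌋₊ = j}

lemma timeBlock_subset (N j : ℕ) : timeBlock N j ⊆ Ioi 0 := fun _ hs => hs.1

lemma measurableSet_timeBlock (N j : ℕ) : MeasurableSet (timeBlock N j) := by
  have h : Measurable fun s : ℝ => ⌊N * Real.exp (-s)⌋₊ :=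
    Nat.measurable_floor.comp (by fun_prop)
  exact measurableSet_Ioi.inter (h (measurableSet_singleton j))

lemma biUnion_timeBlock {N j : ℕ} (hj : 0 < j) (hjN : j ≤ N) :
    ⋃ i ∈ Finset.range j, timeBlock N i = Ioi (Real.log (N / j)) := by
  have hj' : (0 : ℝ) < j := by positivity
  have hN : (0 : ℝ) < N := hj'.trans_le (by exact_mod_cast hjN)
  have h0 : 0 ≤ Real.log (N / j) := Real.log_nonneg (by
    rw [one_le_div hj']; exact_mod_cast hjN)
  have key : ∀ s : ℝ, ⌊N * Real.exp (-s)⌋₊ < j ↔ Real.log (N / j) < s := by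
    intro s
    rw [Nat.floor_lt (by positivity), Real.log_lt_iff_lt_exp (by positivity), div_lt_iff₀ hj',
      Real.exp_neg, ← div_eq_mul_inv, div_lt_iff₀ (Real.exp_pos s), mul_comm (Real.exp s)]
  ext s
  simp only [timeBlock, mem_iUnion, Finset.mem_range, mem_ofPred_eq, mem_Ioi, ← key, exists_prop]
  constructor
  · rintro ⟨i, hi, -, rfl⟩
    exact hi
  · intro h
    exact ⟨_, h, h0.trans_lt ((key s).1 h), rfl⟩

lemma setIntegral_Ioi_log_eq_sum {f : ℝ → ℝ} (hf : IntegrableOn f (Ioi 0)) {N j : ℕ} (hj : 0 < j)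
    (hjN : j ≤ N) :
    ∫ s in Ioi (Real.log (N / j)), f s = ∑ i ∈ Finset.range j, ∫ s in timeBlock N i, f s := by
  rw [← biUnion_timeBlock hj hjN]
  refine integral_biUnion_finset _ (fun i _ => measurableSet_timeBlock N i) ?_
    fun i _ => hf.mono_set (timeBlock_subset N i)
  intro i _ j _ hij
  refine Set.disjoint_left.2 fun s hi hj => hij (hi.2.symm.trans hj.2)

lemma setIntegral_Ioi_zero_eq_sum {f : ℝ → ℝ} (hf : IntegrableOn f (Ioi 0)) {N : ℕ} (hN : 0 < N) :
    ∫ s in Ioi 0, f s = ∑ i ∈ Finset.range N, ∫ s in timeBlock N i, f s := by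
  have hN' : (N : ℝ) ≠ 0 := by positivity
  rw [← setIntegral_Ioi_log_eq_sum hf hN le_rfl, div_self hN', Real.log_one]

lemma exp_neg_log_div {N j : ℕ} (hj : 0 < j) (hjN : j ≤ N) :
    Real.exp (-Real.log (N / j)) = j / N := by
  have : (0 : ℝ) < j := by positivity
  have hN : (0 : ℝ) < N := this.trans_le (by exact_mod_cast hjN)
  rw [← Real.log_inv, Real.exp_log (by positivity), inv_div]

lemma setIntegral_timeBlock_exp_neg {N j : ℕ} (hjN : j < N) :
    ∫ s in timeBlock N j, Real.exp (-s) = 1 / N := by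
  have key : ∀ i, i ≤ N →
      ∑ k ∈ Finset.range i, ∫ s in timeBlock N k, Real.exp (-s) = i / N := by
    intro i hi
    rcases i.eq_zero_or_pos with rfl | h0
    · simp
    rw [← setIntegral_Ioi_log_eq_sum (integrableOn_exp_neg_Ioi 0) h0 hi, integral_exp_neg_Ioi,
      exp_neg_log_div h0 hi]
  have h1 := key (j + 1) hjN
  rw [Finset.sum_range_succ, key j hjN.le] at h1
  push_cast at h1
  rw [add_div] at h1
  linarith

variable {m : ProbabilityMeasure (Fin d)} {η M : ℝ → ProbabilityMeasure (Fin d)}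

lemma Solves.sum_abs_mass_sub_le_of_mem_timeBlock (hη : Measurable η) (h : Solves m η M)
    {N j : ℕ} (hj : 0 < j) {s : ℝ} (hs : s ∈ timeBlock N j) :
    ∑ x, |mass (M (Real.log (N / j))) x - mass (M s) x| ≤ 2 / j := by
  obtain ⟨hs0, hfl⟩ := hs
  have hj' : (0 : ℝ) < j := by positivity
  have h1 := Nat.floor_le (show 0 ≤ N * Real.exp (-s) by positivity)
  have h2 := Nat.lt_floor_add_one (N * Real.exp (-s))
  rw [hfl] at h1 h2
  have hN : (0 : ℝ) < N := by
    rcases N.eq_zero_or_pos with rfl | h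
    · simp at h1; omega
    · exact_mod_cast h
  rw [Real.exp_neg, ← div_eq_mul_inv] at h1 h2
  rw [le_div_iff₀ (Real.exp_pos s)] at h1
  rw [div_lt_iff₀ (Real.exp_pos s)] at h2
  have h3 : s ≤ Real.log (N / j) := by
    rw [Real.le_log_iff_exp_le (by positivity), le_div_iff₀ hj']
    linarith
  refine (h.sum_abs_mass_sub_le hη hs0.le h3).trans ?_
  have h4 : Real.log (N / j) - s ≤ 1 / j := by
    have h5 : (N : ℝ) / j < (1 + 1 / j) * Real.exp s := by
      rw [div_lt_iff₀ hj']
      calc (N : ℝ) < (j + 1) * Real.exp s := h2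
        _ = _ := by field_simp
    have h6 := Real.log_lt_log (by positivity) h5
    rw [Real.log_mul (by positivity) (Real.exp_pos s).ne', Real.log_exp] at h6
    have h7 := Real.log_le_sub_one_of_pos (show (0 : ℝ) < 1 + 1 / j by positivity)
    linarith
  calc 2 * (Real.log (N / j) - s) ≤ 2 * (1 / j) := by linarith
    _ = 2 / j := by ring

/-- The average of a control over a block of times, under the discounting measure. -/
def blockMean (η : ℝ → ProbabilityMeasure (Fin d)) (N j : ℕ) : Fin d → ℝ :=
  fun x => N * ∫ s in timeBlock N j, Real.exp (-s) * mass (η s) x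

lemma integrableOn_timeBlock_mass (hη : Measurable η) (N j : ℕ) (x : Fin d) :
    IntegrableOn (fun s => Real.exp (-s) * mass (η s) x) (timeBlock N j) :=
  (integrableOn_exp_neg_mul_mass hη x 0).mono_set (timeBlock_subset N j)

lemma blockMean_mem_stdSimplex (hη : Measurable η) {N j : ℕ} (hj : j < N) :
    blockMean η N j ∈ stdSimplex ℝ (Fin d) := by
  refine ⟨fun x => mul_nonneg (by positivity) (integral_nonneg fun s =>
    mul_nonneg (Real.exp_pos _).le (mass_nonneg _ _)), ?_⟩
  have hN : (N : ℝ) ≠ 0 := by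
    have : 0 < N := by omega
    positivity
  simp only [blockMean]
  rw [← Finset.mul_sum, ← integral_finsetSum _ fun x _ => integrableOn_timeBlock_mass hη N j x]
  simp only [← Finset.mul_sum, (mass_mem_stdSimplex _).2, mul_one]
  rw [setIntegral_timeBlock_exp_neg hj]
  field_simp

lemma Solves.avg_blockMean (hη : Measurable η) (h : Solves m η M) {N j : ℕ} (hj : 0 < j)
    (hjN : j ≤ N) : avg (blockMean η N) j = mass (M (Real.log (N / j))) := by
  ext x
  have hj' : (0 : ℝ) < j := by positivity
  have hN : (0 : ℝ) < N := hj'.trans_le (by exact_mod_cast hjN)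
  have h0 : 0 ≤ Real.log (N / j) := Real.log_nonneg (by
    rw [one_le_div hj']; exact_mod_cast hjN)
  have key := h.exp_neg_mul_mass hη x h0
  rw [setIntegral_Ioi_log_eq_sum (integrableOn_exp_neg_mul_mass hη x 0) hj hjN,
    exp_neg_log_div hj hjN] at key
  simp only [avg, blockMean]
  rw [← Finset.mul_sum, ← key]
  field_simp

lemma Solves.avg_blockMean_self (hη : Measurable η) (h : Solves m η M) {N : ℕ} (hN : 0 < N) :
    avg (blockMean η N) N = mass m := by
  have hN' : (N : ℝ) ≠ 0 := by positivity
  rw [h.avg_blockMean hη hN le_rfl, div_self hN', Real.log_one]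
  ext x
  simpa using h.dynamics 0 le_rfl x

lemma mul_log_setIntegral_le {N j : ℕ} (hj : j < N) {f : ℝ → ℝ} (hf : Measurable f)
    (hf0 : ∀ s, 0 ≤ f s) (hf1 : ∀ s, f s ≤ 1) :
    (N * ∫ s in timeBlock N j, Real.exp (-s) * f s)
        * Real.log (N * ∫ s in timeBlock N j, Real.exp (-s) * f s)
      ≤ N * ∫ s in timeBlock N j, Real.exp (-s) * (f s * Real.log (f s)) := by
  have hN : (0 : ℝ) < N := by
    have : 0 < N := by omega
    positivity
  set ρ : Measure ℝ := (volume.restrict (timeBlock N j)).withDensity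
    fun s => ENNReal.ofReal (N * Real.exp (-s)) with hρ
  have hint : ∀ g : ℝ → ℝ, ∫ s, g s ∂ρ = N * ∫ s in timeBlock N j, Real.exp (-s) * g s := by
    intro g
    rw [hρ, integral_withDensity_eq_integral_toReal_smul (by fun_prop)
      (Eventually.of_forall fun s => ENNReal.ofReal_lt_top), ← integral_const_mul]
    refine integral_congr_ae (Eventually.of_forall fun s => ?_)
    simp only [smul_eq_mul]
    rw [ENNReal.toReal_ofReal (by positivity)]
    ring
  have hprob : IsProbabilityMeasure ρ := by
    constructor
    rw [hρ, withDensity_apply _ MeasurableSet.univ, Measure.restrict_univ,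
      ← ofReal_integral_eq_lintegral_ofReal, integral_const_mul, setIntegral_timeBlock_exp_neg hj]
    · rw [mul_one_div_cancel hN.ne', ENNReal.ofReal_one]
    · exact (((integrableOn_exp_neg_Ioi 0).mono_set (timeBlock_subset N j))).const_mul _
    · exact Eventually.of_forall fun s => by positivity
  rw [← hint, ← hint]
  refine Real.convexOn_mul_log.map_integral_le Real.continuous_mul_log.continuousOn isClosed_Ici
    (Eventually.of_forall hf0) ?_ ?_
  · exact Integrable.of_bound hf.aestronglyMeasurable 1
      (Eventually.of_forall fun s => by rw [Real.norm_eq_abs, abs_of_nonneg (hf0 s)]; exact hf1 s)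
  · refine Integrable.of_bound (hf.mul hf.log).aestronglyMeasurable 1
      (Eventually.of_forall fun s => ?_)
    simp only [Function.comp, Real.norm_eq_abs]
    rw [mul_comm]
    rcases (hf0 s).eq_or_lt with h | h
    · simp [← h]
    · exact (Real.abs_log_mul_self_lt _ h (hf1 s)).le

variable {A : Matrix (Fin d) (Fin d) ℝ} {δ : ℝ}

lemma relEnt_blockMean_le (hη : Measurable η) {N j : ℕ} (hj : j < N) (q : Fin d → ℝ) :
    relEnt (blockMean η N j) q
      ≤ N * ∫ s in timeBlock N j, Real.exp (-s) * relEnt (mass (η s)) q := by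
  have hi1 : ∀ y, IntegrableOn
      (fun s => Real.exp (-s) * (mass (η s) y * Real.log (mass (η s) y))) (timeBlock N j) := by
    intro y
    refine (integrableOn_exp_neg_mul (C := 1) (t := 0) ?_ fun s _ => ?_).mono_set
      (timeBlock_subset N j)
    · have := measurable_mass_comp hη y
      exact (this.mul this.log).aestronglyMeasurable
    · rw [mul_comm]
      rcases (mass_nonneg (η s) y).eq_or_lt with h | h
      · simp [← h]
      · exact (Real.abs_log_mul_self_lt _ h (mass_le_one _ _)).le
  have hi2 : ∀ y, IntegrableOn
      (fun s => Real.exp (-s) * (mass (η s) y * Real.log (q y))) (timeBlock N j) := by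
    intro y
    simp only [← mul_assoc]
    exact (integrableOn_timeBlock_mass hη N j y).mul_const _
  simp only [relEnt, Finset.mul_sum, mul_sub]
  rw [integral_finsetSum Finset.univ (f := fun y s => Real.exp (-s) * (mass (η s) y
    * Real.log (mass (η s) y)) - Real.exp (-s) * (mass (η s) y * Real.log (q y)))
    fun y _ => (hi1 y).sub (hi2 y), Finset.mul_sum]
  refine Finset.sum_le_sum fun y _ => ?_
  rw [integral_sub (hi1 y) (hi2 y), mul_sub]
  refine sub_le_sub (mul_log_setIntegral_le hj (measurable_mass_comp hη y)
    (fun s => mass_nonneg _ _) fun s => mass_le_one _ _) (le_of_eq ?_)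
  simp only [← mul_assoc, integral_mul_const, blockMean]

/-- The harmonic sum, in the form in which discretisation errors appear. -/
def harmonicSum (n : ℕ) : ℝ := ∑ j ∈ Finset.range n, 2 / ((j + 1 : ℕ) : ℝ)

lemma relEnt_le_runningCost_add (hA : IsStochasticGe A δ) (hη : Measurable η) (h : Solves m η M)
    {N j : ℕ} (hj : 0 < j) (hjN : j ≤ N) {s : ℝ} (hs : s ∈ timeBlock N j) :
    |relEnt (mass (η s)) (avg (blockMean η N) j ᵥ* A) - runningCost A η M s| ≤ δ⁻¹ * (2 / j) := by
  have h1 := h.sum_abs_mass_sub_le_of_mem_timeBlock hη hj hs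
  have h2 := mul_le_mul_of_nonneg_left h1 (inv_pos.2 hA.pos).le
  have h3 : mass (η s) ∈ stdSimplex ℝ (Fin d) := mass_mem_stdSimplex _
  have h4 := relEnt_vecMul_le_add hA h3 (mass_mem_stdSimplex (M (Real.log (N / j))))
    (mass_mem_stdSimplex (M s))
  have h5 := relEnt_vecMul_le_add hA h3 (mass_mem_stdSimplex (M s))
    (mass_mem_stdSimplex (M (Real.log (N / j))))
  simp only [abs_sub_comm (mass (M s) _)] at h5
  rw [h.avg_blockMean hη hj hjN, runningCost, abs_le]
  constructor <;> linarith

lemma integrableOn_relEnt (hA : IsStochasticGe A δ) (hη : Measurable η) {v : Fin d → ℝ}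
    (hv : v ∈ stdSimplex ℝ (Fin d)) (B : Set ℝ) (hB : B ⊆ Ioi 0) :
    IntegrableOn (fun s => Real.exp (-s) * relEnt (mass (η s)) (v ᵥ* A)) B := by
  refine (integrableOn_exp_neg_mul (C := δ⁻¹) (t := 0) ?_ fun s _ => ?_).mono_set hB
  · refine Measurable.aestronglyMeasurable ?_
    unfold relEnt
    refine Finset.measurable_fun_sum _ fun y _ => ?_
    have := measurable_mass_comp hη y
    exact (this.mul this.log).sub (this.mul_const _)
  · rw [abs_of_nonneg (relEnt_vecMul_nonneg hA (mass_mem_stdSimplex _) hv)]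
    exact relEnt_vecMul_le hA (mass_mem_stdSimplex _) hv

lemma abs_setIntegral_relEnt_sub_le (hA : IsStochasticGe A δ) (hη : Measurable η)
    (h : Solves m η M) {N j : ℕ} (hj : 0 < j) (hjN : j < N) :
    |(N * ∫ s in timeBlock N j, Real.exp (-s)
        * relEnt (mass (η s)) (avg (blockMean η N) j ᵥ* A))
      - N * ∫ s in timeBlock N j, Real.exp (-s) * runningCost A η M s| ≤ δ⁻¹ * (2 / j) := by
  have hN : (0 : ℝ) < N := by
    have : 0 < N := by omega
    positivity
  have hv : avg (blockMean η N) j ∈ stdSimplex ℝ (Fin d) := by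
    rw [h.avg_blockMean hη hj hjN.le]; exact mass_mem_stdSimplex _
  have hi1 := integrableOn_relEnt hA hη hv (timeBlock N j) (timeBlock_subset N j)
  have hi2 := (h.integrableOn_runningCost hA hη).mono_set (timeBlock_subset N j)
  rw [← mul_sub, ← integral_sub hi1 hi2, abs_mul, abs_of_pos hN]
  have hi3 : IntegrableOn (fun s => Real.exp (-s) * (δ⁻¹ * (2 / j))) (timeBlock N j) :=
    ((integrableOn_exp_neg_Ioi 0).mono_set (timeBlock_subset N j)).mul_const _
  have h1 : ‖∫ s in timeBlock N j, (Real.exp (-s)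
        * relEnt (mass (η s)) (avg (blockMean η N) j ᵥ* A)
      - Real.exp (-s) * runningCost A η M s)‖
      ≤ ∫ s in timeBlock N j, Real.exp (-s) * (δ⁻¹ * (2 / j)) := by
    refine norm_integral_le_of_norm_le hi3 ?_
    filter_upwards [ae_restrict_mem (measurableSet_timeBlock N j)] with s hs
    rw [← mul_sub, Real.norm_eq_abs, abs_mul, abs_of_pos (Real.exp_pos _)]
    exact mul_le_mul_of_nonneg_left (relEnt_le_runningCost_add hA hη h hj hjN.le hs)
      (Real.exp_pos _).le
  rw [integral_mul_const, setIntegral_timeBlock_exp_neg hjN, Real.norm_eq_abs] at h1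
  calc _ ≤ N * (1 / N * (δ⁻¹ * (2 / j))) := mul_le_mul_of_nonneg_left h1 hN.le
    _ = _ := by field_simp

/-- Block averages of a control have discrete cost at most the cost of the control, up to a
harmonic sum. -/
lemma exists_seq_of_rate_lt (hA : IsStochasticGe A δ) {c : ℝ}
    (hc : rate A m < ENNReal.ofReal c) (n : ℕ) :
    ∃ β : ℕ → Fin d → ℝ, (∀ j, β j ∈ stdSimplex ℝ (Fin d)) ∧ avg β (n + 1) = mass m ∧
      seqCost A n β ≤ (n + 1) * c + δ⁻¹ * harmonicSum n := by
  obtain ⟨η, M, hη, h, hlt⟩ := exists_solves_of_rate_lt hA hc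
  have hlt' := (ENNReal.ofReal_lt_ofReal_iff'.1 hlt).1
  set β : ℕ → Fin d → ℝ := fun j => if j < n + 1 then blockMean η (n + 1) j else mass m with hβ
  have hβj : ∀ j, j < n + 1 → β j = blockMean η (n + 1) j := fun j hj => if_pos hj
  have havg : ∀ j, j ≤ n + 1 → avg β j = avg (blockMean η (n + 1)) j := by
    intro j hj
    ext x
    simp only [avg]
    rw [Finset.sum_congr rfl fun i hi => by
      rw [hβj i ((Finset.mem_range.1 hi).trans_le hj)]]
  refine ⟨β, fun j => ?_, ?_, ?_⟩
  · by_cases hj : j < n + 1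
    · rw [hβj j hj]; exact blockMean_mem_stdSimplex hη hj
    · rw [hβ]; simp only [hj, if_false]; exact mass_mem_stdSimplex m
  · rw [havg _ le_rfl]
    exact h.avg_blockMean_self hη n.succ_pos
  · have h0 : 0 ≤ ∫ s in timeBlock (n + 1) 0, Real.exp (-s) * runningCost A η M s :=
      integral_nonneg fun s => mul_nonneg (Real.exp_pos _).le (runningCost_nonneg hA s)
    have hsum := setIntegral_Ioi_zero_eq_sum (h.integrableOn_runningCost hA hη) n.succ_pos
    rw [Nat.succ_eq_add_one, Finset.sum_range_succ'] at hsum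
    have hstep : ∀ j ∈ Finset.range n, relEnt (β (j + 1)) (avg β (j + 1) ᵥ* A)
        ≤ ((n + 1 : ℕ) : ℝ) * (∫ s in timeBlock (n + 1) (j + 1), Real.exp (-s)
            * runningCost A η M s)
          + δ⁻¹ * (2 / ((j + 1 : ℕ) : ℝ)) := by
      intro j hj
      have hj' : j + 1 < n + 1 := by simpa using hj
      rw [hβj _ hj', havg _ hj'.le]
      have h1 := relEnt_blockMean_le hη hj' (avg (blockMean η (n + 1)) (j + 1) ᵥ* A)
      have h2 := (abs_le.1 (abs_setIntegral_relEnt_sub_le hA hη h j.succ_pos hj')).2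
      simp only [Nat.succ_eq_add_one] at h2
      linarith
    calc seqCost A n β ≤ _ := Finset.sum_le_sum hstep
      _ = ((n + 1 : ℕ) : ℝ) * ∑ j ∈ Finset.range n, (∫ s in timeBlock (n + 1) (j + 1),
            Real.exp (-s) * runningCost A η M s) + δ⁻¹ * harmonicSum n := by
          rw [Finset.sum_add_distrib, ← Finset.mul_sum, ← Finset.mul_sum, harmonicSum]
      _ ≤ _ := by
          push_cast
          gcongr
          linarith

/-- A sequence of probability vectors gives a piecewise constant control whose cost is at most the
discrete cost, up to a harmonic sum. -/
lemma mul_rate_toReal_le (hA : IsStochasticGe A δ) {η : ℕ → Fin d → ℝ}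
    (hη : ∀ j, η j ∈ stdSimplex ℝ (Fin d)) (n : ℕ) (hm : mass m = avg η (n + 1)) :
    (n + 1) * (rate A m).toReal ≤ seqCost A n η + δ⁻¹ * (1 + harmonicSum n) := by
  set θ : ℝ → ProbabilityMeasure (Fin d) :=
    fun s => ofVec (η ⌊((n + 1 : ℕ) : ℝ) * Real.exp (-s)⌋₊) (hη _) with hθ
  have hθm : Measurable θ := by
    have h1 : Measurable fun s : ℝ => ⌊((n + 1 : ℕ) : ℝ) * Real.exp (-s)⌋₊ :=
      Nat.measurable_floor.comp (by fun_prop)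
    exact (measurable_from_top (f := fun j : ℕ => ofVec (η j) (hη j))).comp h1
  have hθmass : ∀ j, ∀ s ∈ timeBlock (n + 1) j, mass (θ s) = η j := by
    intro j s hs
    rw [hθ]
    simp only [mass_ofVec, hs.2]
  have hN : (0 : ℝ) < ((n + 1 : ℕ) : ℝ) := by positivity
  have hbm : ∀ j, j < n + 1 → blockMean θ (n + 1) j = η j := by
    intro j hj
    ext x
    simp only [blockMean]
    rw [setIntegral_congr_fun (g := fun s => Real.exp (-s) * η j x)
      (measurableSet_timeBlock (n + 1) j) (fun s hs => by simp only [hθmass j s hs]),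
      integral_mul_const, setIntegral_timeBlock_exp_neg hj]
    field_simp
  have havg : ∀ j, j ≤ n + 1 → avg (blockMean θ (n + 1)) j = avg η j := by
    intro j hj
    ext x
    simp only [avg]
    rw [Finset.sum_congr rfl fun i hi => by
      rw [hbm i ((Finset.mem_range.1 hi).trans_le hj)]]
  obtain ⟨M, h⟩ : ∃ M, Solves m θ M := by
    refine exists_solves hθm fun x => ?_
    rw [setIntegral_Ioi_zero_eq_sum (integrableOn_exp_neg_mul_mass hθm x 0) n.succ_pos, hm,
      ← havg _ le_rfl]
    simp only [avg, blockMean, Nat.succ_eq_add_one]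
    rw [← Finset.mul_sum, ← mul_assoc, inv_mul_cancel₀ hN.ne', one_mul]
  have hrate := ENNReal.toReal_mono ENNReal.ofReal_ne_top (rate_le_of_solves hA hθm h)
  rw [ENNReal.toReal_ofReal (integral_nonneg fun s =>
    mul_nonneg (Real.exp_pos _).le (runningCost_nonneg hA s)),
    setIntegral_Ioi_zero_eq_sum (h.integrableOn_runningCost hA hθm) n.succ_pos,
    Nat.succ_eq_add_one, Finset.sum_range_succ'] at hrate
  have h0 : ((n + 1 : ℕ) : ℝ) * ∫ s in timeBlock (n + 1) 0, Real.exp (-s) * runningCost A θ M s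
      ≤ δ⁻¹ := by
    calc ((n + 1 : ℕ) : ℝ) * ∫ s in timeBlock (n + 1) 0, Real.exp (-s) * runningCost A θ M s
        ≤ ((n + 1 : ℕ) : ℝ) * ∫ s in timeBlock (n + 1) 0, Real.exp (-s) * δ⁻¹ := by
          refine mul_le_mul_of_nonneg_left ?_ hN.le
          exact setIntegral_mono
            ((h.integrableOn_runningCost hA hθm).mono_set (timeBlock_subset _ _))
            (((integrableOn_exp_neg_Ioi 0).mono_set (timeBlock_subset _ _)).mul_const _)
            fun s => mul_le_mul_of_nonneg_left (runningCost_le hA s) (Real.exp_pos _).le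
      _ = δ⁻¹ := by
          rw [integral_mul_const, setIntegral_timeBlock_exp_neg n.succ_pos]
          field_simp
  have hstep : ∀ j ∈ Finset.range n,
      ((n + 1 : ℕ) : ℝ) * ∫ s in timeBlock (n + 1) (j + 1), Real.exp (-s) * runningCost A θ M s
        ≤ relEnt (η (j + 1)) (avg η (j + 1) ᵥ* A) + δ⁻¹ * (2 / ((j + 1 : ℕ) : ℝ)) := by
    intro j hj
    have hj' : j + 1 < n + 1 := by simpa using hj
    have h2 := (abs_le.1 (abs_setIntegral_relEnt_sub_le hA hθm h j.succ_pos hj')).1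
    simp only [Nat.succ_eq_add_one] at h2
    rw [setIntegral_congr_fun (measurableSet_timeBlock (n + 1) (j + 1))
      (g := fun s => Real.exp (-s) * relEnt (η (j + 1)) (avg η (j + 1) ᵥ* A))
      (fun s hs => by simp only [hθmass _ s hs, havg _ hj'.le]),
      integral_mul_const, setIntegral_timeBlock_exp_neg hj', ← mul_assoc,
      mul_one_div_cancel hN.ne', one_mul] at h2
    linarith
  have hsum := Finset.sum_le_sum hstep
  rw [← Finset.mul_sum, Finset.sum_add_distrib, ← Finset.mul_sum] at hsum
  have h3 := mul_le_mul_of_nonneg_left hrate hN.le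
  rw [mul_add] at h3
  push_cast at h3 h0 hsum
  simp only [seqCost, harmonicSum]
  push_cast
  linarith

end Blocks

/-! ### Compactness of the sublevel sets -/

section RateFunction

variable {A : Matrix (Fin d) (Fin d) ℝ} {δ : ℝ}

lemma tendsto_sum_div_add_one {u : ℕ → ℝ} (hu : Tendsto u atTop (𝓝 0)) :
    Tendsto (fun n : ℕ => (∑ j ∈ Finset.range n, u j) / ((n : ℝ) + 1)) atTop (𝓝 0) := by
  have h1 : Tendsto (fun n : ℕ => (n : ℝ) / (n + 1)) atTop (𝓝 1) := by
    simpa using tendsto_natCast_div_add_atTop (1 : ℝ)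
  have h2 := hu.cesaro.mul h1
  simp only [zero_mul] at h2
  refine h2.congr fun n => ?_
  rcases n.eq_zero_or_pos with rfl | hn
  · simp
  · have : (n : ℝ) ≠ 0 := by positivity
    field_simp

lemma tendsto_harmonicSum_div :
    Tendsto (fun n : ℕ => harmonicSum n / ((n : ℝ) + 1)) atTop (𝓝 0) := by
  refine tendsto_sum_div_add_one ?_
  exact (tendsto_const_div_atTop_nhds_zero_nat (2 : ℝ)).comp (tendsto_add_atTop_nat 1)

lemma continuous_avg_apply (k : ℕ) (x : Fin d) :
    Continuous fun η : ℕ → Fin d → ℝ => avg η k x := by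
  unfold avg
  fun_prop

lemma continuousOn_seqCost (hA : IsStochasticGe A δ) (n : ℕ) :
    ContinuousOn (seqCost A n) {η | ∀ j, η j ∈ stdSimplex ℝ (Fin d)} := by
  unfold seqCost relEnt
  refine continuousOn_finsetSum _ fun j _ => continuousOn_finsetSum _ fun y _ => ?_
  have h1 : Continuous fun η : ℕ → Fin d → ℝ => η (j + 1) y := by fun_prop
  refine (Real.continuous_mul_log.comp h1).continuousOn.sub (h1.continuousOn.mul ?_)
  refine ContinuousOn.log ?_ fun η hη => (hA.vecMul_pos (avg_mem_stdSimplex hη j.succ_pos) y).ne'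
  simp only [Matrix.vecMul, dotProduct]
  exact Continuous.continuousOn <| continuous_finsetSum _ fun x _ =>
    (continuous_avg_apply _ x).mul continuous_const

lemma isClosed_setOf_exists_seqCost_le (hA : IsStochasticGe A δ) (n : ℕ) (c : ℝ) :
    IsClosed {m : ProbabilityMeasure (Fin d) | ∃ η : ℕ → Fin d → ℝ,
      (∀ j, η j ∈ stdSimplex ℝ (Fin d)) ∧ avg η (n + 1) = mass m ∧ seqCost A n η ≤ c} := by
  have hcomp : IsCompact {η : ℕ → Fin d → ℝ | ∀ j, η j ∈ stdSimplex ℝ (Fin d)} := by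
    have := isCompact_univ_pi fun _ : ℕ => isCompact_stdSimplex ℝ (Fin d)
    simpa [Set.pi] using this
  have h1 := (continuousOn_seqCost hA n).preimage_isClosed_of_isClosed hcomp.isClosed
    (isClosed_Iic (a := c))
  have h2 := hcomp.of_isClosed_subset h1 inter_subset_left
  have h3 : Continuous fun η : ℕ → Fin d → ℝ => avg η (n + 1) :=
    continuous_pi fun x => continuous_avg_apply _ x
  have h4 := ((h2.image h3).isClosed).preimage (continuous_mass (d := d))
  convert! h4 using 1
  ext m
  constructor
  · rintro ⟨η, hη, hm, hc⟩
    exact ⟨η, ⟨hη, hc⟩, hm⟩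
  · rintro ⟨η, ⟨hη, hc⟩, hm⟩
    exact ⟨η, hη, hm, hc⟩

lemma isRateFunction_rate (hA : IsStochasticGe A δ) : IsRateFunction (rate A) := by
  intro k
  refine IsClosed.isCompact ?_
  have : {m : ProbabilityMeasure (Fin d) | rate A m ≤ k} = ⋂ n : ℕ,
      {m | ∃ η : ℕ → Fin d → ℝ, (∀ j, η j ∈ stdSimplex ℝ (Fin d)) ∧ avg η (n + 1) = mass m ∧
        seqCost A n η ≤ (n + 1) * (k + 1 / ((n : ℝ) + 1)) + δ⁻¹ * harmonicSum n} := by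
    ext m
    simp only [mem_iInter, mem_ofPred_eq]
    constructor
    · intro hm n
      refine exists_seq_of_rate_lt hA ?_ n
      refine hm.trans_lt ?_
      rw [← ENNReal.ofReal_coe_nnreal, ENNReal.ofReal_lt_ofReal_iff (by positivity)]
      have : (0 : ℝ) < 1 / ((n : ℝ) + 1) := by positivity
      linarith
    · intro hm
      have hbound : ∀ n : ℕ, (rate A m).toReal
          ≤ k + 1 / ((n : ℝ) + 1) + (2 * δ⁻¹ * (harmonicSum n / ((n : ℝ) + 1))
            + δ⁻¹ * (1 / ((n : ℝ) + 1))) := by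
        intro n
        obtain ⟨η, hη, havg, hc⟩ := hm n
        have h1 := mul_rate_toReal_le hA hη n havg.symm
        have hn : (0 : ℝ) < (n : ℝ) + 1 := by positivity
        rw [← mul_le_mul_iff_right₀ hn]
        refine (h1.trans (add_le_add_left hc _)).trans (le_of_eq ?_)
        field_simp
        ring
      have hlim : Tendsto (fun n : ℕ => (k : ℝ) + 1 / ((n : ℝ) + 1)
          + (2 * δ⁻¹ * (harmonicSum n / ((n : ℝ) + 1)) + δ⁻¹ * (1 / ((n : ℝ) + 1))))
          atTop (𝓝 k) := by
        have h1 := tendsto_one_div_add_atTop_nhds_zero_nat (𝕜 := ℝ)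
        simpa using (tendsto_const_nhds.add h1).add
          ((tendsto_harmonicSum_div.const_mul (2 * δ⁻¹)).add (h1.const_mul δ⁻¹))
      have := ge_of_tendsto' hlim hbound
      rw [← ENNReal.ofReal_toReal (rate_ne_top hA m), ← ENNReal.ofReal_coe_nnreal]
      exact ENNReal.ofReal_le_ofReal this
  rw [this]
  exact isClosed_iInter fun n => isClosed_setOf_exists_seqCost_le hA n _

end RateFunction

/-! ### The law of a path of the reinforced chain -/

section Paths

/-- The unit vectors along a sequence of states. -/
def unitVec (x : ℕ → Fin d) (i : ℕ) : Fin d → ℝ := Pi.single (x i) 1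

lemma unitVec_mem_stdSimplex (x : ℕ → Fin d) (i : ℕ) : unitVec x i ∈ stdSimplex ℝ (Fin d) :=
  single_mem_stdSimplex ℝ (x i)

lemma mass_empiricalMeasure (x : ℕ → Fin d) (n : ℕ) :
    mass (empiricalMeasure x n) = avg (unitVec x) (n + 1) := by
  ext y
  simp only [mass, empiricalMeasure, ProbabilityMeasure.coe_mk, Measure.real, avg, unitVec]
  rw [Measure.smul_apply, Measure.finsetSum_apply, smul_eq_mul,
    ENNReal.toReal_mul, ENNReal.toReal_sum (fun i _ => measure_ne_top _ _)]
  congr 1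
  · rw [ENNReal.toReal_inv, ENNReal.toReal_natCast]
  · refine Finset.sum_congr rfl fun i _ => ?_
    by_cases h : x i = y <;> simp [h]

lemma nextLaw_real_singleton {A : Matrix (Fin d) (Fin d) ℝ} {δ : ℝ} (hA : IsStochasticGe A δ)
    (m : ProbabilityMeasure (Fin d)) (y : Fin d) :
    (nextLaw A m).real {y} = (mass m ᵥ* A) y := by
  rw [nextLaw_eq, Measure.real, weightedDirac_singleton,
    ENNReal.toReal_ofReal (hA.vecMul_pos (mass_mem_stdSimplex m) y).le]

lemma avg_congr {η θ : ℕ → Fin d → ℝ} {k : ℕ} (h : ∀ i < k, η i = θ i) : avg η k = avg θ k := by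
  ext x
  simp only [avg]
  rw [Finset.sum_congr rfl fun i hi => by rw [h i (Finset.mem_range.1 hi)]]

lemma empiricalMeasure_congr {x y : ℕ → Fin d} {n : ℕ} (h : ∀ i ≤ n, x i = y i) :
    empiricalMeasure x n = empiricalMeasure y n := by
  apply mass_injective
  rw [mass_empiricalMeasure, mass_empiricalMeasure]
  refine avg_congr fun i hi => ?_
  rw [unitVec, unitVec, h i (by omega)]

/-- The probability that the reinforced chain follows the path `x` during its first `n` steps. -/
def pathProb (A : Matrix (Fin d) (Fin d) ℝ) (x₀ : Fin d) (x : ℕ → Fin d) (n : ℕ) : ℝ :=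
  (if x 0 = x₀ then 1 else 0)
    * ∏ k ∈ Finset.range n, (avg (unitVec x) (k + 1) ᵥ* A) (x (k + 1))

/-- The information generated by the first `n + 1` states. -/
abbrev history {Ω : Type*} (X : ℕ → Ω → Fin d) (n : ℕ) : MeasurableSpace Ω :=
  ⨆ k ≤ n, MeasurableSpace.comap (X k) inferInstance

lemma measurableSet_history {Ω : Type*} (X : ℕ → Ω → Fin d) (x : ℕ → Fin d) (n : ℕ) :
    MeasurableSet[history X n] {ω | ∀ k ≤ n, X k ω = x k} := by
  have : {ω | ∀ k ≤ n, X k ω = x k} = ⋂ k, ⋂ (_ : k ≤ n), X k ⁻¹' {x k} := by ext; simp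
  rw [this]
  refine MeasurableSet.iInter fun k => MeasurableSet.iInter fun hk => ?_
  exact (le_iSup₂_of_le (f := fun k (_ : k ≤ n) =>
    MeasurableSpace.comap (X k) inferInstance) k hk le_rfl) _
      ⟨{x k}, measurableSet_singleton _, rfl⟩

variable {Ω : Type*} [MeasurableSpace Ω] {P : Measure Ω}
  {A : Matrix (Fin d) (Fin d) ℝ} {δ : ℝ} {x₀ : Fin d} {X : ℕ → Ω → Fin d}

lemma IsReinforcedChain.history_le (hX : IsReinforcedChain P A x₀ X) (n : ℕ) :
    history X n ≤ ‹MeasurableSpace Ω› :=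
  iSup₂_le fun k _ => (hX.measurable k).comap_le

lemma IsReinforcedChain.measureReal_path [IsProbabilityMeasure P] (hA : IsStochasticGe A δ)
    (hX : IsReinforcedChain P A x₀ X) (x : ℕ → Fin d) (n : ℕ) :
    P.real {ω | ∀ k ≤ n, X k ω = x k} = pathProb A x₀ x n := by
  induction n with
  | zero =>
    simp only [nonpos_iff_eq_zero, forall_eq, hX.init, pathProb, Finset.range_zero,
      Finset.prod_empty, mul_one]
    by_cases h : x 0 = x₀
    · simp [h]
    · have : ¬ x₀ = x 0 := fun h' => h h'.symm
      simp [h, this]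
  | succ n ih =>
    set E : Set Ω := {ω | ∀ k ≤ n, X k ω = x k} with hE
    have hEm : MeasurableSet[history X n] E := measurableSet_history X x n
    have hXm : MeasurableSet (X (n + 1) ⁻¹' {x (n + 1)}) :=
      hX.measurable (n + 1) (measurableSet_singleton _)
    have hsplit : {ω | ∀ k ≤ n + 1, X k ω = x k} = E ∩ X (n + 1) ⁻¹' {x (n + 1)} := by
      ext ω
      simp only [hE, mem_ofPred_eq, mem_inter_iff, mem_preimage, mem_singleton_iff]
      constructor
      · exact fun h => ⟨fun k hk => h k (by omega), h _ le_rfl⟩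
      · rintro ⟨h1, h2⟩ k hk
        rcases Nat.le_succ_iff.1 hk with h | rfl
        · exact h1 k h
        · exact h2
    have h1 : ∫ ω in E, (X (n + 1) ⁻¹' {x (n + 1)}).indicator (fun _ => (1 : ℝ)) ω ∂P
        = P.real (E ∩ X (n + 1) ⁻¹' {x (n + 1)}) := by
      rw [setIntegral_indicator hXm]
      simp
    have h2 := setIntegral_condExp (hX.history_le n) (μ := P) (s := E)
      (f := (X (n + 1) ⁻¹' {x (n + 1)}).indicator (fun _ => (1 : ℝ)))
      ((integrable_const 1).indicator hXm) hEm
    have h3 : ∫ ω in E, (P[(X (n + 1) ⁻¹' {x (n + 1)}).indicator (fun _ => (1 : ℝ)) | history X n]) ω ∂P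
        = ∫ ω in E, (avg (unitVec x) (n + 1) ᵥ* A) (x (n + 1)) ∂P := by
      refine setIntegral_congr_ae (hX.history_le n _ hEm) ?_
      filter_upwards [hX.step n (x (n + 1))] with ω hω hωE
      rw [hω, nextLaw_real_singleton hA, empiricalMeasure_congr (fun i hi => hωE i hi),
        mass_empiricalMeasure]
    rw [hsplit, ← h1, ← h2, h3, setIntegral_const, ih, pathProb, pathProb, Finset.prod_range_succ,
      smul_eq_mul, mul_assoc]

/-- Extension of a finite path by a constant. -/
def extendPath (x₀ : Fin d) {N : ℕ} (x : Fin N → Fin d) (k : ℕ) : Fin d :=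
  if h : k < N then x ⟨k, h⟩ else x₀

lemma extendPath_of_lt (x₀ : Fin d) {N : ℕ} (x : Fin N → Fin d) {k : ℕ} (h : k < N) :
    extendPath x₀ x k = x ⟨k, h⟩ := dif_pos h

lemma IsReinforcedChain.measureReal_empiricalMeasure_mem [IsProbabilityMeasure P]
    (hA : IsStochasticGe A δ)
    (hX : IsReinforcedChain P A x₀ X) (n : ℕ) (F : Set (ProbabilityMeasure (Fin d)))
    [DecidablePred fun x : Fin (n + 1) → Fin d => empiricalMeasure (extendPath x₀ x) n ∈ F] :
    P.real {ω | empiricalMeasure (fun i => X i ω) n ∈ F}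
      = ∑ x : Fin (n + 1) → Fin d with empiricalMeasure (extendPath x₀ x) n ∈ F,
          pathProb A x₀ (extendPath x₀ x) n := by
  set T : Ω → Fin (n + 1) → Fin d := fun ω i => X i ω with hT
  have hTm : Measurable T := measurable_pi_iff.2 fun i => hX.measurable i
  have hfib : ∀ x : Fin (n + 1) → Fin d,
      P.real (T ⁻¹' {x}) = pathProb A x₀ (extendPath x₀ x) n := by
    intro x
    rw [← hX.measureReal_path hA]
    congr 1
    ext ω
    simp only [hT, mem_preimage, mem_singleton_iff, mem_ofPred_eq, funext_iff]
    constructor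
    · intro h k hk
      rw [extendPath_of_lt x₀ x (Nat.lt_succ_of_le hk)]
      exact h ⟨k, Nat.lt_succ_of_le hk⟩
    · intro h i
      have := h i (Nat.le_of_lt_succ i.2)
      rwa [extendPath_of_lt x₀ x i.2] at this
  have hext : ∀ ω, empiricalMeasure (fun i => X i ω) n
      = empiricalMeasure (extendPath x₀ (T ω)) n := by
    intro ω
    refine empiricalMeasure_congr fun i hi => ?_
    rw [extendPath_of_lt x₀ (T ω) (Nat.lt_succ_of_le hi)]
  have hset : {ω | empiricalMeasure (fun i => X i ω) n ∈ F}
      = T ⁻¹' (Finset.univ.filter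
          fun x : Fin (n + 1) → Fin d => empiricalMeasure (extendPath x₀ x) n ∈ F) := by
    ext ω
    simp [hext]
  rw [hset, ← sum_measureReal_preimage_singleton _ (fun y _ => hTm (measurableSet_singleton y))]
  exact Finset.sum_congr rfl fun x _ => hfib x

end Paths

/-! ### Block averages of a path -/

section BlockAverages

lemma sum_abs_avg_sub_le {η : ℕ → Fin d → ℝ} (hη : ∀ i, η i ∈ stdSimplex ℝ (Fin d)) {b k : ℕ}
    (hb : 0 < b) (hbk : b ≤ k) :
    ∑ x, |avg η k x - avg η b x| ≤ 2 * ((k - b : ℕ) : ℝ) / k := by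
  have hk : (0 : ℝ) < k := by
    have := hb.trans_le hbk
    positivity
  have hkey : ∀ x, k * (avg η k x - avg η b x) = ∑ i ∈ Finset.Ico b k, (η i x - avg η b x) := by
    intro x
    rw [mul_sub, mul_avg, ← Finset.sum_range_add_sum_Ico _ hbk, ← mul_avg η b,
      Finset.sum_sub_distrib]
    simp only [Finset.sum_const, Nat.card_Ico, nsmul_eq_mul]
    rw [Nat.cast_sub hbk]
    ring
  have h1 : k * ∑ x, |avg η k x - avg η b x| ≤ 2 * ((k - b : ℕ) : ℝ) := by
    rw [Finset.mul_sum]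
    calc ∑ x, k * |avg η k x - avg η b x|
        ≤ ∑ x, ∑ i ∈ Finset.Ico b k, |η i x - avg η b x| := by
          refine Finset.sum_le_sum fun x _ => ?_
          calc k * |avg η k x - avg η b x| = |k * (avg η k x - avg η b x)| := by
                rw [abs_mul, Nat.abs_cast]
            _ ≤ _ := by
                rw [hkey]
                exact Finset.abs_sum_le_sum_abs _ _
      _ = ∑ i ∈ Finset.Ico b k, ∑ x, |η i x - avg η b x| := Finset.sum_comm
      _ ≤ ∑ i ∈ Finset.Ico b k, (2 : ℝ) :=
          Finset.sum_le_sum fun i _ => sum_abs_sub_le_two (hη i) (avg_mem_stdSimplex hη hb)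
      _ = _ := by simp [mul_comm]
  rw [le_div_iff₀ hk]
  linarith

/-- The sequence obtained from the unit vectors along the first `N` states of `x` by averaging
over blocks of length `B`. -/
def blockAvg (N B : ℕ) (x : ℕ → Fin d) (k : ℕ) : Fin d → ℝ :=
  if k < N then fun y => (({i ∈ Finset.range N | i / B = k / B} : Finset ℕ).card : ℝ)⁻¹
    * ∑ i ∈ Finset.range N with i / B = k / B, unitVec x i y
  else unitVec x k

variable {N B : ℕ} {x : ℕ → Fin d}

lemma card_block_pos {k : ℕ} (hk : k < N) :
    (0 : ℝ) < (({i ∈ Finset.range N | i / B = k / B} : Finset ℕ).card : ℝ) := by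
  have : 0 < ({i ∈ Finset.range N | i / B = k / B} : Finset ℕ).card :=
    Finset.card_pos.2 ⟨k, by simp [hk]⟩
  exact_mod_cast this

lemma blockAvg_mem_stdSimplex (N B : ℕ) (x : ℕ → Fin d) (k : ℕ) :
    blockAvg N B x k ∈ stdSimplex ℝ (Fin d) := by
  unfold blockAvg
  split_ifs with hk
  · refine ⟨fun y => mul_nonneg (by positivity) (Finset.sum_nonneg fun i _ =>
      (unitVec_mem_stdSimplex x i).1 y), ?_⟩
    rw [← Finset.mul_sum, Finset.sum_comm,
      Finset.sum_congr rfl fun i _ => (unitVec_mem_stdSimplex x i).2, Finset.sum_const,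
      nsmul_eq_mul, mul_one, inv_mul_cancel₀ (card_block_pos hk).ne']
  · exact unitVec_mem_stdSimplex x k

lemma blockAvg_pos {k : ℕ} (hk : k < N) : 0 < blockAvg N B x k (x k) := by
  rw [blockAvg, if_pos hk]
  refine mul_pos (inv_pos.2 (card_block_pos hk)) ?_
  refine Finset.sum_pos' (fun i _ => (unitVec_mem_stdSimplex x i).1 _) ⟨k, by simp [hk], ?_⟩
  simp [unitVec]

lemma sum_unitVec_mul (x : ℕ → Fin d) (i : ℕ) (g : Fin d → ℝ) :
    ∑ y, unitVec x i y * g y = g (x i) := by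
  simp [unitVec, Pi.single_apply]

/-- Averaging over blocks does not change the sums of functions of the block and the state. -/
lemma sum_blockAvg_mul (f : ℕ → Fin d → ℝ) :
    ∑ k ∈ Finset.range N, ∑ y, blockAvg N B x k y * f (k / B) y
      = ∑ k ∈ Finset.range N, f (k / B) (x k) := by
  have h1 : ∀ k ∈ Finset.range N, ∑ y, blockAvg N B x k y * f (k / B) y
      = ∑ i ∈ Finset.range N, if i / B = k / B then
          (({l ∈ Finset.range N | l / B = i / B} : Finset ℕ).card : ℝ)⁻¹ * f (i / B) (x i)
        else 0 := by
    intro k hk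
    rw [← Finset.sum_filter]
    simp only [blockAvg, if_pos (Finset.mem_range.1 hk)]
    simp_rw [mul_assoc, ← Finset.mul_sum, Finset.sum_mul]
    rw [Finset.sum_comm, Finset.mul_sum]
    refine Finset.sum_congr rfl fun i hi => ?_
    rw [sum_unitVec_mul, (Finset.mem_filter.1 hi).2]
  rw [Finset.sum_congr rfl h1, Finset.sum_comm]
  refine Finset.sum_congr rfl fun i hi => ?_
  simp_rw [eq_comm (a := i / B)]
  rw [← Finset.sum_filter, Finset.sum_const, nsmul_eq_mul, ← mul_assoc,
    mul_inv_cancel₀ (card_block_pos (Finset.mem_range.1 hi)).ne', one_mul]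

lemma avg_blockAvg_self : avg (blockAvg N B x) N = avg (unitVec x) N := by
  ext y
  have h := sum_blockAvg_mul (N := N) (B := B) (x := x) fun _ z => if z = y then 1 else 0
  simp only [mul_ite, mul_one, mul_zero, Finset.sum_ite_eq', Finset.mem_univ, if_true] at h
  simp only [avg, h]
  congr 1
  refine Finset.sum_congr rfl fun i _ => ?_
  simp [unitVec, Pi.single_apply, eq_comm]

lemma avg_blockAvg_mul (hB : 0 < B) {j : ℕ} (hj : j * B ≤ N) :
    avg (blockAvg N B x) (j * B) = avg (unitVec x) (j * B) := by
  ext y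
  have h := sum_blockAvg_mul (N := N) (B := B) (x := x)
    fun i z => if z = y then (if i < j then 1 else 0) else 0
  simp only [mul_ite, mul_one, mul_zero, Finset.sum_ite_eq', Finset.mem_univ, if_true,
    Nat.div_lt_iff_lt_mul hB] at h
  have hr : ∀ g : ℕ → ℝ, ∑ k ∈ Finset.range N, (if k < j * B then g k else 0)
      = ∑ k ∈ Finset.range (j * B), g k := by
    intro g
    rw [← Finset.sum_filter]
    congr 1
    ext k
    simp only [Finset.mem_filter, Finset.mem_range]
    omega
  simp only [avg]
  congr 1
  rw [← hr, ← hr, h]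
  refine Finset.sum_congr rfl fun i _ => ?_
  by_cases h1 : x i = y <;> simp [unitVec, h1]

lemma blockAvg_div_mul (hB : 0 < B) {k : ℕ} (hk : k < N) :
    blockAvg N B x (k / B * B) = blockAvg N B x k := by
  have h1 : k / B * B < N := (Nat.div_mul_le_self k B).trans_lt hk
  rw [blockAvg, blockAvg, if_pos hk, if_pos h1, Nat.mul_div_cancel _ hB]

lemma sum_log_blockAvg (hB : 0 < B) :
    ∑ k ∈ Finset.range N, Real.log (blockAvg N B x k (x k))
      = ∑ k ∈ Finset.range N, ∑ y, blockAvg N B x k y * Real.log (blockAvg N B x k y) := by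
  have h := sum_blockAvg_mul (N := N) (B := B) (x := x)
    fun i y => Real.log (blockAvg N B x (i * B) y)
  have h1 : ∀ k ∈ Finset.range N, blockAvg N B x (k / B * B) = blockAvg N B x k :=
    fun k hk => blockAvg_div_mul hB (Finset.mem_range.1 hk)
  rw [Finset.sum_congr rfl fun k hk => by rw [← h1 k hk], ← h]
  refine Finset.sum_congr rfl fun k hk => ?_
  rw [h1 k hk]

variable {A : Matrix (Fin d) (Fin d) ℝ} {δ : ℝ}

/-- The logarithm of the transition probability at the beginning of the `j`-th block. -/
def blockLog (A : Matrix (Fin d) (Fin d) ℝ) (B : ℕ) (x : ℕ → Fin d) (j : ℕ) (y : Fin d) : ℝ :=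
  if j = 0 then 0 else Real.log ((avg (unitVec x) (j * B) ᵥ* A) y)

lemma abs_log_sub_blockLog_le (hA : IsStochasticGe A δ) {η : ℕ → Fin d → ℝ}
    (hη : ∀ i, η i ∈ stdSimplex ℝ (Fin d)) (hB : 0 < B) {k : ℕ} (hk : 0 < k)
    (hηx : avg η (k / B * B) = avg (unitVec x) (k / B * B)) (y : Fin d) :
    |Real.log ((avg η k ᵥ* A) y) - blockLog A B x (k / B) y| ≤ δ⁻¹ * B * (2 / k) := by
  have hk' : (0 : ℝ) < k := by positivity
  have hδ : 0 < δ⁻¹ := inv_pos.2 hA.pos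
  have hs := avg_mem_stdSimplex hη hk
  unfold blockLog
  split_ifs with h0
  · have h1 : (k : ℝ) ≤ B := by
      have := (Nat.div_eq_zero_iff_lt hB).1 h0
      exact_mod_cast this.le
    rw [sub_zero, abs_of_nonpos (hA.log_vecMul_nonpos hs y)]
    refine (hA.neg_log_vecMul_le hs y).trans ?_
    rw [mul_assoc]
    refine le_mul_of_one_le_right hδ.le ?_
    rw [mul_div_assoc', one_le_div hk']
    linarith
  · have hb : 0 < k / B * B := by positivity
    have hbk : k / B * B ≤ k := Nat.div_mul_le_self k B
    have hb' := avg_mem_stdSimplex hη hb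
    have h1 := sum_abs_avg_sub_le hη hb hbk
    have h2 : ((k - k / B * B : ℕ) : ℝ) ≤ B := by
      have h3 := Nat.div_add_mod' k B
      have h4 := Nat.mod_lt k hB
      exact_mod_cast (show k - k / B * B ≤ B by omega)
    have h3 : δ⁻¹ * ∑ z, |avg η k z - avg η (k / B * B) z| ≤ δ⁻¹ * B * (2 / k) := by
      rw [mul_assoc]
      refine mul_le_mul_of_nonneg_left (h1.trans ?_) hδ.le
      rw [mul_div_assoc', div_le_div_iff_of_pos_right hk']
      linarith
    rw [← hηx, abs_le]
    have h4 := hA.log_vecMul_sub_le hs hb' y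
    have h5 := hA.log_vecMul_sub_le hb' hs y
    simp only [abs_sub_comm (avg η (k / B * B) _)] at h5
    constructor <;> linarith

lemma sum_blockLog (n : ℕ) (g : ℕ → Fin d → ℝ) :
    ∑ k ∈ Finset.range (n + 1), ∑ y, g k y * blockLog A B x (k / B) y
      = ∑ k ∈ Finset.range n, ∑ y, g (k + 1) y * blockLog A B x ((k + 1) / B) y := by
  rw [Finset.sum_range_succ']
  simp [blockLog]

lemma neg_mul_log_sum_le {p : Fin d → ℝ} (hp : p ∈ stdSimplex ℝ (Fin d)) :
    -∑ y, p y * Real.log (p y) ≤ d := by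
  rw [← Finset.sum_neg_distrib]
  calc ∑ y, -(p y * Real.log (p y)) ≤ ∑ _y : Fin d, (1 : ℝ) := by
        refine Finset.sum_le_sum fun y _ => ?_
        have h1 := mem_Icc_of_mem_stdSimplex hp y
        rcases h1.1.eq_or_lt with h | h
        · simp [← h]
        · have := Real.abs_log_mul_self_lt _ h h1.2
          rw [mul_comm] at this
          linarith [(abs_lt.1 this).1]
    _ = d := by simp

/-- The log-likelihood of a path is at most that of independent draws from its block averages,
less the discrete cost of the block averages, up to an error governed by the block length. -/
lemma sum_log_le (hA : IsStochasticGe A δ) (hB : 0 < B) (n : ℕ) (x : ℕ → Fin d) :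
    ∑ j ∈ Finset.range n, Real.log ((avg (unitVec x) (j + 1) ᵥ* A) (x (j + 1)))
      ≤ ∑ k ∈ Finset.range (n + 1), Real.log (blockAvg (n + 1) B x k (x k))
        - seqCost A n (blockAvg (n + 1) B x) + d + 2 * (δ⁻¹ * B * harmonicSum n) := by
  set θ := blockAvg (n + 1) B x with hθ
  have hθs : ∀ k, θ k ∈ stdSimplex ℝ (Fin d) := blockAvg_mem_stdSimplex _ _ _
  have h1 : ∑ j ∈ Finset.range n, Real.log ((avg (unitVec x) (j + 1) ᵥ* A) (x (j + 1)))
      ≤ ∑ k ∈ Finset.range (n + 1), ∑ y, θ k y * blockLog A B x (k / B) y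
        + δ⁻¹ * B * harmonicSum n := by
    rw [hθ, sum_blockAvg_mul]
    simp_rw [← sum_unitVec_mul x _ (blockLog A B x _)]
    rw [sum_blockLog, harmonicSum, Finset.mul_sum, ← Finset.sum_add_distrib]
    refine Finset.sum_le_sum fun j _ => ?_
    rw [sum_unitVec_mul]
    have := (abs_le.1 (abs_log_sub_blockLog_le hA (unitVec_mem_stdSimplex x) hB j.succ_pos rfl
      (x (j + 1)))).2
    simp only [Nat.succ_eq_add_one] at this
    linarith
  have h2 : ∑ k ∈ Finset.range (n + 1), ∑ y, θ k y * blockLog A B x (k / B) y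
      ≤ ∑ j ∈ Finset.range n, ∑ y, θ (j + 1) y * Real.log ((avg θ (j + 1) ᵥ* A) y)
        + δ⁻¹ * B * harmonicSum n := by
    rw [sum_blockLog, harmonicSum, Finset.mul_sum, ← Finset.sum_add_distrib]
    refine Finset.sum_le_sum fun j hj => ?_
    have hjN : (j + 1) / B * B ≤ n + 1 :=
      (Nat.div_mul_le_self _ B).trans (by have := Finset.mem_range.1 hj; omega)
    calc ∑ y, θ (j + 1) y * blockLog A B x ((j + 1) / B) y
        ≤ ∑ y, (θ (j + 1) y * Real.log ((avg θ (j + 1) ᵥ* A) y)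
            + θ (j + 1) y * (δ⁻¹ * B * (2 / ((j + 1 : ℕ) : ℝ)))) := by
          refine Finset.sum_le_sum fun y _ => ?_
          rw [← mul_add]
          refine mul_le_mul_of_nonneg_left ?_ ((hθs _).1 y)
          have := (abs_le.1 (abs_log_sub_blockLog_le hA hθs hB j.succ_pos
            (avg_blockAvg_mul hB hjN) y)).1
          simp only [Nat.succ_eq_add_one] at this
          linarith
      _ = _ := by rw [Finset.sum_add_distrib, ← Finset.sum_mul, (hθs _).2, one_mul]
  have h3 : ∑ j ∈ Finset.range n, ∑ y, θ (j + 1) y * Real.log ((avg θ (j + 1) ᵥ* A) y)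
      = ∑ k ∈ Finset.range (n + 1), Real.log (θ k (x k)) - ∑ y, θ 0 y * Real.log (θ 0 y)
        - seqCost A n θ := by
    rw [hθ, sum_log_blockAvg hB, ← hθ, Finset.sum_range_succ', seqCost]
    simp only [relEnt, Finset.sum_sub_distrib]
    ring
  have h4 := neg_mul_log_sum_le (hθs 0)
  linarith

end BlockAverages

/-! ### The upper bound -/

section UpperBound

variable {A : Matrix (Fin d) (Fin d) ℝ} {δ : ℝ} {x₀ : Fin d}

lemma sum_le_card_of_fiber {α W : Type*} [Fintype α] [Fintype W] (τ : α → W) (q : α → α → ℝ)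
    (hq : ∀ x y, 0 ≤ q x y) (hτ : ∀ x y, τ x = τ y → q x x = q y x)
    (hsum : ∀ y, ∑ x, q y x ≤ 1) : ∑ x, q x x ≤ Fintype.card W := by
  classical
  calc ∑ x, q x x = ∑ w : W, ∑ x with τ x = w, q x x :=
        (Finset.sum_fiberwise Finset.univ τ fun x => q x x).symm
    _ ≤ ∑ _w : W, (1 : ℝ) := by
        refine Finset.sum_le_sum fun w _ => ?_
        by_cases h : ∃ y, τ y = w
        · obtain ⟨y, rfl⟩ := h
          calc ∑ x with τ x = τ y, q x x = ∑ x with τ x = τ y, q y x :=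
                Finset.sum_congr rfl fun x hx => hτ x y (Finset.mem_filter.1 hx).2
            _ ≤ ∑ x, q y x := Finset.sum_le_sum_of_subset_of_nonneg (Finset.filter_subset _ _)
                fun x _ _ => hq y x
            _ ≤ 1 := hsum y
        · push Not at h
          rw [Finset.filter_false_of_mem fun x _ => h x]
          simp
    _ = Fintype.card W := by simp

lemma sum_prod_eq_one {N : ℕ} {q : ℕ → Fin d → ℝ} (hq : ∀ k, q k ∈ stdSimplex ℝ (Fin d)) :
    ∑ x : Fin N → Fin d, ∏ k : Fin N, q k (x k) = 1 := by
  have := Finset.prod_univ_sum (fun _ : Fin N => (Finset.univ : Finset (Fin d)))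
    fun k y => q k y
  rw [Fintype.piFinset_univ] at this
  rw [← this]
  exact Finset.prod_eq_one fun k _ => (hq k).2

/-- The numbers of visits to the states in each block. -/
def blockCount (N B : ℕ) (x : ℕ → Fin d) (j : Fin (N / B + 1)) (y : Fin d) : Fin (N + 1) :=
  ⟨({i ∈ Finset.range N | i / B = j ∧ x i = y} : Finset ℕ).card, by
    have := Finset.card_filter_le (Finset.range N) fun i => i / B = j ∧ x i = y
    rw [Finset.card_range] at this
    omega⟩

lemma blockAvg_eq_blockCount {N B : ℕ} (x : ℕ → Fin d) {k : ℕ} (hk : k < N) (y : Fin d) :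
    blockAvg N B x k y = (({i ∈ Finset.range N | i / B = k / B} : Finset ℕ).card : ℝ)⁻¹
      * (blockCount N B x ⟨k / B, Nat.lt_succ_of_le (Nat.div_le_div_right hk.le)⟩ y : ℕ) := by
  rw [blockAvg, if_pos hk]
  simp only [blockCount, unitVec, Pi.single_apply]
  congr 1
  rw [← Finset.filter_filter, ← Finset.sum_boole]
  simp_rw [eq_comm (a := y)]

lemma blockAvg_eq_of_blockCount_eq {N B : ℕ} {x y : ℕ → Fin d}
    (h : blockCount N B x = blockCount N B y) {k : ℕ} (hk : k < N) :
    blockAvg N B x k = blockAvg N B y k := by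
  ext z
  rw [blockAvg_eq_blockCount x hk, blockAvg_eq_blockCount y hk, h]

/-- Up to the number of types, the paths are no more likely than exponential in their cost. -/
lemma pathProb_le (hA : IsStochasticGe A δ) {B : ℕ} (hB : 0 < B) (n : ℕ) (x : ℕ → Fin d) :
    pathProb A x₀ x n ≤ (∏ k : Fin (n + 1), blockAvg (n + 1) B x k (x k))
      * Real.exp (-((n + 1) * (rate A (empiricalMeasure x n)).toReal)
        + (d + 2 * (δ⁻¹ * B * harmonicSum n) + δ⁻¹ * (1 + harmonicSum n))) := by
  have hθ := blockAvg_mem_stdSimplex (n + 1) B x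
  have hpos : ∀ k : Fin (n + 1), 0 < blockAvg (n + 1) B x k (x k) := fun k => blockAvg_pos k.2
  have h1 := mul_rate_toReal_le hA hθ n (m := empiricalMeasure x n)
    (by rw [mass_empiricalMeasure, avg_blockAvg_self])
  have h2 := sum_log_le hA hB n x
  have hstep : ∀ j, 0 < (avg (unitVec x) (j + 1) ᵥ* A) (x (j + 1)) := fun j =>
    hA.vecMul_pos (avg_mem_stdSimplex (unitVec_mem_stdSimplex x) j.succ_pos) _
  calc pathProb A x₀ x n
      ≤ ∏ k ∈ Finset.range n, (avg (unitVec x) (k + 1) ᵥ* A) (x (k + 1)) := by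
        unfold pathProb
        have := Finset.prod_nonneg fun k (_ : k ∈ Finset.range n) => (hstep k).le
        split_ifs <;> simp [this]
    _ = Real.exp (∑ j ∈ Finset.range n,
          Real.log ((avg (unitVec x) (j + 1) ᵥ* A) (x (j + 1)))) := by
        rw [Real.exp_sum]
        exact Finset.prod_congr rfl fun k _ => (Real.exp_log (hstep k)).symm
    _ ≤ Real.exp (∑ k ∈ Finset.range (n + 1), Real.log (blockAvg (n + 1) B x k (x k))
          + (-((n + 1) * (rate A (empiricalMeasure x n)).toReal)
            + (d + 2 * (δ⁻¹ * B * harmonicSum n) + δ⁻¹ * (1 + harmonicSum n)))) :=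
        Real.exp_le_exp.2 (by linarith)
    _ = _ := by
        rw [Real.exp_add, Real.exp_sum, Finset.prod_range]
        congr 1
        exact Finset.prod_congr rfl fun k _ => Real.exp_log (hpos k)

variable {Ω : Type*} [MeasurableSpace Ω] {P : Measure Ω} {X : ℕ → Ω → Fin d}

lemma IsReinforcedChain.measureReal_mem_le [IsProbabilityMeasure P] (hA : IsStochasticGe A δ)
    (hX : IsReinforcedChain P A x₀ X) {F : Set (ProbabilityMeasure (Fin d))} {c : ℝ}
    (hc : ∀ m ∈ F, c ≤ (rate A m).toReal) {B : ℕ} (hB : 0 < B) (n : ℕ) :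
    P.real {ω | empiricalMeasure (fun i => X i ω) n ∈ F}
      ≤ ((n + 2 : ℕ) : ℝ) ^ (d * ((n + 1) / B + 1)) * Real.exp (-((n + 1) * c)
        + (d + 2 * (δ⁻¹ * B * harmonicSum n) + δ⁻¹ * (1 + harmonicSum n))) := by
  classical
  rw [hX.measureReal_empiricalMeasure_mem hA]
  set E : ℝ := d + 2 * (δ⁻¹ * B * harmonicSum n) + δ⁻¹ * (1 + harmonicSum n) with hE
  set q : (Fin (n + 1) → Fin d) → (Fin (n + 1) → Fin d) → ℝ :=
    fun y x => ∏ k : Fin (n + 1), blockAvg (n + 1) B (extendPath x₀ y) k (x k) with hq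
  have hq0 : ∀ y x, 0 ≤ q y x := fun y x =>
    Finset.prod_nonneg fun k _ => (blockAvg_mem_stdSimplex _ _ _ _).1 _
  have hqcard : ∑ x, q x x ≤ ((n + 2 : ℕ) : ℝ) ^ (d * ((n + 1) / B + 1)) := by
    refine (sum_le_card_of_fiber (fun x => blockCount (n + 1) B (extendPath x₀ x)) q hq0 ?_
      fun y => (sum_prod_eq_one (blockAvg_mem_stdSimplex _ _ _)).le).trans (le_of_eq ?_)
    · intro x y hxy
      exact Finset.prod_congr rfl fun k _ => by rw [blockAvg_eq_of_blockCount_eq hxy k.2]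
    · simp only [Fintype.card_pi, Finset.prod_const, Fintype.card_fin, Finset.card_univ]
      push_cast
      rw [← pow_mul]
      norm_num [add_assoc]
  calc ∑ x : Fin (n + 1) → Fin d with empiricalMeasure (extendPath x₀ x) n ∈ F,
          pathProb A x₀ (extendPath x₀ x) n
      ≤ ∑ x : Fin (n + 1) → Fin d with empiricalMeasure (extendPath x₀ x) n ∈ F,
          q x x * Real.exp (-((n + 1) * c) + E) := by
        refine Finset.sum_le_sum fun x hx => ?_
        have hmem := (Finset.mem_filter.1 hx).2
        refine (pathProb_le hA hB n (extendPath x₀ x)).trans ?_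
        have h1 : ∏ k : Fin (n + 1),
            blockAvg (n + 1) B (extendPath x₀ x) k (extendPath x₀ x k) = q x x :=
          Finset.prod_congr rfl fun k _ => by rw [extendPath_of_lt x₀ x k.2]
        rw [h1]
        refine mul_le_mul_of_nonneg_left (Real.exp_le_exp.2 ?_) (hq0 x x)
        have h2 : ((n : ℝ) + 1) * c
            ≤ ((n : ℝ) + 1) * (rate A (empiricalMeasure (extendPath x₀ x) n)).toReal :=
          mul_le_mul_of_nonneg_left (hc _ hmem) (by positivity)
        linarith
    _ ≤ ∑ x : Fin (n + 1) → Fin d, q x x * Real.exp (-((n + 1) * c) + E) :=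
        Finset.sum_le_sum_of_subset_of_nonneg (Finset.filter_subset _ _)
          fun x _ _ => mul_nonneg (hq0 x x) (Real.exp_pos _).le
    _ ≤ _ := by
        rw [← Finset.sum_mul]
        exact mul_le_mul_of_nonneg_right hqcard (Real.exp_pos _).le

lemma harmonicSum_le (n : ℕ) : harmonicSum n ≤ 2 * (1 + Real.log (n + 2)) := by
  have h1 := harmonic_le_one_add_log n
  have h2 : harmonicSum n = 2 * (harmonic n : ℝ) := by
    simp [harmonicSum, harmonic, Finset.mul_sum, div_eq_mul_inv]
  have h3 : Real.log n ≤ Real.log (n + 2) := by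
    rcases n.eq_zero_or_pos with rfl | hn
    · simpa using Real.log_nonneg (by norm_num : (1 : ℝ) ≤ 2)
    · exact Real.log_le_log (by positivity) (by linarith)
  rw [h2]
  linarith

lemma harmonicSum_nonneg (n : ℕ) : 0 ≤ harmonicSum n :=
  Finset.sum_nonneg fun _ _ => by positivity

/-- The total error in the upper bound, with blocks of length about `√n`. -/
def upperError (d : ℕ) (δ : ℝ) (n : ℕ) : ℝ :=
  (d * ((n + 1) / Nat.sqrt (n + 1) + 1) : ℕ) * Real.log ((n + 2 : ℕ) : ℝ)
    + (d + 2 * (δ⁻¹ * Nat.sqrt (n + 1) * harmonicSum n) + δ⁻¹ * (1 + harmonicSum n))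

lemma upperError_le (hδ : 0 < δ) (n : ℕ) :
    upperError d δ n ≤ (5 * d + 7 * δ⁻¹) * (√((n : ℝ) + 2) * (1 + Real.log (n + 2))) := by
  set l := Real.log ((n : ℝ) + 2) with hl
  set r := √((n : ℝ) + 2) with hr
  have hl0 : 0 ≤ l := Real.log_nonneg (by linarith [(n.cast_nonneg : (0 : ℝ) ≤ n)])
  have hr1 : 1 ≤ r := Real.one_le_sqrt.2 (by linarith [(n.cast_nonneg : (0 : ℝ) ≤ n)])
  have hδ' : 0 < δ⁻¹ := inv_pos.2 hδ
  set B := Nat.sqrt (n + 1) with hB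
  have hBr : (B : ℝ) ≤ r := by
    refine Real.le_sqrt_of_sq_le ?_
    have := Nat.sqrt_le' (n + 1)
    rw [← hB] at this
    have h2 : ((B ^ 2 : ℕ) : ℝ) ≤ ((n + 1 : ℕ) : ℝ) := by exact_mod_cast this
    push_cast at h2
    linarith
  have hB0 : 0 < B := Nat.sqrt_pos.2 n.succ_pos
  have hdiv : (n + 1) / B + 1 ≤ B + 3 := by
    have h1 := Nat.sqrt_le_add (n + 1)
    rw [← hB] at h1
    have : (n + 1) / B ≤ B + 2 := by
      refine Nat.div_le_of_le_mul ?_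
      nlinarith
    omega
  have hdiv' : (((n + 1) / B + 1 : ℕ) : ℝ) ≤ B + 3 := by exact_mod_cast hdiv
  have hh := harmonicSum_le n
  rw [← hl] at hh
  have hh0 := harmonicSum_nonneg n
  have hB1 : (0 : ℝ) ≤ B := by positivity
  have e1 : (d * ((n + 1) / B + 1) : ℕ) * Real.log ((n + 2 : ℕ) : ℝ) ≤ 4 * d * (r * (1 + l)) := by
    have : Real.log ((n + 2 : ℕ) : ℝ) = l := by push_cast; rfl
    rw [this, Nat.cast_mul]
    calc (d : ℝ) * (((n + 1) / B + 1 : ℕ) : ℝ) * l ≤ d * (4 * r) * (1 + l) := by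
          gcongr <;> linarith
      _ = _ := by ring
  have e2 : (d : ℝ) ≤ d * (r * (1 + l)) :=
    le_mul_of_one_le_right (by positivity) (by nlinarith)
  have e3 : 2 * (δ⁻¹ * B * harmonicSum n) ≤ 4 * δ⁻¹ * (r * (1 + l)) := by
    calc 2 * (δ⁻¹ * B * harmonicSum n) ≤ 2 * (δ⁻¹ * r * (2 * (1 + l))) := by gcongr
      _ = _ := by ring
  have e4 : δ⁻¹ * (1 + harmonicSum n) ≤ 3 * δ⁻¹ * (r * (1 + l)) := by
    calc δ⁻¹ * (1 + harmonicSum n) ≤ δ⁻¹ * (3 * (r * (1 + l))) := by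
          gcongr
          nlinarith
      _ = _ := by ring
  unfold upperError
  rw [← hB]
  linarith

lemma tendsto_upperError_div (hδ : 0 < δ) :
    Tendsto (fun n : ℕ => (upperError d δ n) / n) atTop (𝓝 0) := by
  have hx : Tendsto (fun n : ℕ => (n : ℝ) + 2) atTop atTop :=
    tendsto_atTop_add_const_right _ _ tendsto_natCast_atTop_atTop
  have h1 : Tendsto (fun x : ℝ => (1 + Real.log x) / √x) atTop (𝓝 0) := by
    have h2 := (isLittleO_log_rpow_atTop (show (0 : ℝ) < 1 / 2 by norm_num)).tendsto_div_nhds_zero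
    have h3 : Tendsto (fun x : ℝ => 1 / √x) atTop (𝓝 0) := by
      simp only [one_div]
      exact tendsto_inv_atTop_zero.comp Real.tendsto_sqrt_atTop
    simp only [← Real.sqrt_eq_rpow] at h2
    simpa [add_div] using h3.add h2
  have h2 := ((h1.comp hx).const_mul (3 * (5 * d + 7 * δ⁻¹)))
  rw [mul_zero] at h2
  refine squeeze_zero' (Eventually.of_forall fun n => ?_) ?_ h2
  · have := harmonicSum_nonneg n
    have hl : 0 ≤ Real.log ((n + 2 : ℕ) : ℝ) := Real.log_natCast_nonneg _
    unfold upperError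
    positivity
  · filter_upwards [eventually_ge_atTop 1] with n hn
    have hn' : (1 : ℝ) ≤ n := by exact_mod_cast hn
    have hn0 : (0 : ℝ) < n := by linarith
    have hl0 : 0 ≤ Real.log ((n : ℝ) + 2) := Real.log_nonneg (by linarith)
    have hr : 0 < √((n : ℝ) + 2) := Real.sqrt_pos.2 (by linarith)
    have hsq : √((n : ℝ) + 2) * √((n : ℝ) + 2) = n + 2 := Real.mul_self_sqrt (by linarith)
    have hδ' : 0 < δ⁻¹ := inv_pos.2 hδ
    rw [div_le_iff₀ hn0]
    refine (upperError_le hδ n).trans ?_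
    simp only [Function.comp]
    have : √((n : ℝ) + 2) * (1 + Real.log (n + 2))
        ≤ 3 * ((1 + Real.log ((n : ℝ) + 2)) / √((n : ℝ) + 2)) * n := by
      rw [mul_div_assoc', div_mul_eq_mul_div, le_div_iff₀ hr]
      nlinarith
    calc _ ≤ (5 * d + 7 * δ⁻¹) * (3 * ((1 + Real.log ((n : ℝ) + 2)) / √((n : ℝ) + 2)) * n) :=
          mul_le_mul_of_nonneg_left this (by positivity)
      _ = _ := by ring

lemma IsReinforcedChain.limsup_le [IsProbabilityMeasure P] (hA : IsStochasticGe A δ)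
    (hX : IsReinforcedChain P A x₀ X) (F : Set (ProbabilityMeasure (Fin d))) :
    limsup (fun n : ℕ =>
        ENNReal.log (P {ω | empiricalMeasure (fun i => X i ω) n ∈ F}) / (n : EReal)) atTop
      ≤ -((⨅ m ∈ F, rate A m : ℝ≥0∞) : EReal) := by
  have key : ∀ c : ℝ, 0 ≤ c → ENNReal.ofReal c ≤ ⨅ m ∈ F, rate A m →
      limsup (fun n : ℕ =>
        ENNReal.log (P {ω | empiricalMeasure (fun i => X i ω) n ∈ F}) / (n : EReal)) atTop
      ≤ ((-c : ℝ) : EReal) := by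
    intro c hc0 hc
    have hc' : ∀ m ∈ F, c ≤ (rate A m).toReal := fun m hm =>
      (ENNReal.ofReal_le_iff_le_toReal (rate_ne_top hA m)).1 (hc.trans (iInf₂_le m hm))
    have hlim : Tendsto (fun n : ℕ => ((-c + upperError d δ n / n : ℝ) : EReal)) atTop
        (𝓝 ((-c : ℝ) : EReal)) := by
      refine (continuous_coe_real_ereal.tendsto _).comp ?_
      simpa using tendsto_const_nhds.add (tendsto_upperError_div (d := d) hA.pos)
    rw [← hlim.limsup_eq]
    refine limsup_le_limsup ?_
    filter_upwards [eventually_ge_atTop 1] with n hn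
    have hn' : (1 : ℝ) ≤ n := by exact_mod_cast hn
    have hn0 : (0 : ℝ) < n := by linarith
    have h1 := hX.measureReal_mem_le hA hc' (Nat.sqrt_pos.2 n.succ_pos) n
    have h2 : ((n + 2 : ℕ) : ℝ) ^ (d * ((n + 1) / Nat.sqrt (n + 1) + 1))
        * Real.exp (-((n + 1) * c) + (d + 2 * (δ⁻¹ * Nat.sqrt (n + 1) * harmonicSum n)
          + δ⁻¹ * (1 + harmonicSum n))) = Real.exp (-((n + 1) * c) + upperError d δ n) := by
      have hpos : (0 : ℝ) < ((n + 2 : ℕ) : ℝ) ^ (d * ((n + 1) / Nat.sqrt (n + 1) + 1)) := by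
        positivity
      rw [← Real.exp_log hpos, ← Real.exp_add, Real.log_pow, upperError]
      congr 1
      ring
    have h3 : P {ω | empiricalMeasure (fun i => X i ω) n ∈ F}
        ≤ ENNReal.ofReal (Real.exp (-((n + 1) * c) + upperError d δ n)) := by
      rw [← ofReal_measureReal]
      exact ENNReal.ofReal_le_ofReal (h1.trans_eq h2)
    have h4 := ENNReal.log_monotone h3
    rw [ENNReal.log_ofReal_of_pos (Real.exp_pos _), Real.log_exp] at h4
    calc ENNReal.log (P {ω | empiricalMeasure (fun i => X i ω) n ∈ F}) / (n : EReal)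
        ≤ ((-((n + 1) * c) + upperError d δ n : ℝ) : EReal) / ((n : ℝ) : EReal) :=
          EReal.div_le_div_right_of_nonneg (by positivity) h4
      _ = (((-((n + 1) * c) + upperError d δ n) / n : ℝ) : EReal) := (EReal.coe_div _ _).symm
      _ ≤ _ := by
          rw [EReal.coe_le_coe_iff, add_div]
          have : -((n + 1) * c) / n ≤ -c := by
            rw [div_le_iff₀ hn0]
            linarith
          linarith
  rw [EReal.le_neg]
  refine le_of_forall_lt fun z hz => ?_
  obtain ⟨r, hzr, hr⟩ := EReal.lt_iff_exists_real_btwn.1 hz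
  refine hzr.trans_le ?_
  have h1 : ENNReal.ofReal (max r 0) ≤ ⨅ m ∈ F, rate A m := by
    rcases le_total r 0 with h | h
    · simp [h]
    · rw [max_eq_left h, ← EReal.coe_ennreal_le_coe_ennreal_iff, EReal.coe_ennreal_ofReal,
        max_eq_left h]
      exact hr.le
  have h2 := key _ (le_max_right r 0) h1
  rw [EReal.le_neg]
  refine h2.trans ?_
  rw [← EReal.coe_neg, EReal.coe_le_coe_iff]
  exact neg_le_neg (le_max_left r 0)

end UpperBound

/-! ### Independent draws -/

section Independent

lemma sum_fin_ite_lt {N k : ℕ} (hk : k ≤ N) (g : ℕ → ℝ) :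
    ∑ i : Fin N, (if (i : ℕ) < k then g i else 0) = ∑ i ∈ Finset.range k, g i := by
  rw [Fin.sum_univ_eq_sum_range (fun i => if i < k then g i else 0), ← Finset.sum_filter]
  congr 1
  ext i
  simp only [Finset.mem_filter, Finset.mem_range]
  omega

/-- The law of independent draws with the laws `q 0, …, q (N - 1)`. -/
def indepLaw (q : ℕ → Fin d → ℝ) (hq : ∀ k, q k ∈ stdSimplex ℝ (Fin d)) (N : ℕ) :
    Measure (Fin N → Fin d) :=
  Measure.pi fun k : Fin N => (ofVec (q k) (hq k) : Measure (Fin d))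

variable {q : ℕ → Fin d → ℝ} (hq : ∀ k, q k ∈ stdSimplex ℝ (Fin d)) {N : ℕ}

instance : IsProbabilityMeasure (indepLaw q hq N) := by
  unfold indepLaw
  infer_instance

lemma ofVec_real_singleton (v : Fin d → ℝ) (hv : v ∈ stdSimplex ℝ (Fin d)) (y : Fin d) :
    (ofVec v hv : Measure (Fin d)).real {y} = v y :=
  congrFun (mass_ofVec v hv) y

lemma integral_ofVec (v : Fin d → ℝ) (hv : v ∈ stdSimplex ℝ (Fin d)) (g : Fin d → ℝ) :
    ∫ y, g y ∂(ofVec v hv : Measure (Fin d)) = ∑ y, v y * g y := by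
  rw [integral_fintype Integrable.of_finite]
  simp only [ofVec_real_singleton, smul_eq_mul]

lemma indepLaw_real_singleton (x : Fin N → Fin d) :
    (indepLaw q hq N).real {x} = ∏ k : Fin N, q k (x k) := by
  rw [indepLaw, Measure.real, Measure.pi_singleton, ENNReal.toReal_prod]
  exact Finset.prod_congr rfl fun k _ => ofVec_real_singleton _ _ _

lemma integral_indepLaw (f : (Fin N → Fin d) → ℝ) :
    ∫ x, f x ∂(indepLaw q hq N) = ∑ x, (∏ k : Fin N, q k (x k)) * f x := by
  rw [integral_fintype Integrable.of_finite]
  simp only [indepLaw_real_singleton, smul_eq_mul]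

lemma integral_indepLaw_apply (k : Fin N) (g : Fin d → ℝ) :
    ∫ x, g (x k) ∂(indepLaw q hq N) = ∑ y, q k y * g y := by
  have h := integral_comp_eval (μ := fun k : Fin N => (ofVec (q k) (hq k) : Measure (Fin d)))
    (i := k) (measurable_of_finite g).aestronglyMeasurable
  rw [indepLaw, h, integral_ofVec]

/-- Quantitative weak law of large numbers for the empirical frequencies. -/
lemma integral_abs_avg_sub_le {k : ℕ} (hk : 0 < k) (hkN : k ≤ N) (x₀ y : Fin d) :
    ∫ x, |avg (unitVec (extendPath x₀ x)) k y - avg q k y| ∂(indepLaw q hq N) ≤ 1 / √k := by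
  have hk' : (0 : ℝ) < k := by positivity
  have hr : 0 < √(k : ℝ) := Real.sqrt_pos.2 hk'
  set Z : Fin N → Fin d → ℝ :=
    fun i z => if (i : ℕ) < k then (Pi.single z 1 : Fin d → ℝ) y else 0 with hZ
  set S : (Fin N → Fin d) → ℝ := ∑ i, fun x => Z i (x i) with hS
  have hSx : ∀ x, S x = k * avg (unitVec (extendPath x₀ x)) k y := by
    intro x
    rw [mul_avg, ← sum_fin_ite_lt hkN, hS, Finset.sum_apply]
    refine Finset.sum_congr rfl fun i _ => ?_
    simp only [hZ, unitVec, extendPath_of_lt x₀ x i.2]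
  have hmean : ∫ x, S x ∂(indepLaw q hq N) = k * avg q k y := by
    simp only [hS, Finset.sum_apply]
    rw [integral_finsetSum _ fun i _ => Integrable.of_finite, mul_avg, ← sum_fin_ite_lt hkN]
    refine Finset.sum_congr rfl fun i _ => ?_
    rw [integral_indepLaw_apply hq i (Z i)]
    simp only [hZ]
    split_ifs
    · simp [Pi.single_apply]
    · simp
  have hvar : ∫ x, (S x - k * avg q k y) ^ 2 ∂(indepLaw q hq N) ≤ k := by
    rw [← hmean, ← variance_eq_integral (measurable_of_finite S).aemeasurable, hS, indepLaw,
      variance_sum_pi fun i => MemLp.of_discrete]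
    calc ∑ i : Fin N, Var[Z i; (ofVec (q i) (hq i) : Measure (Fin d))]
        ≤ ∑ i : Fin N, (if (i : ℕ) < k then (fun _ => (1 : ℝ)) (i : ℕ) else 0) := by
          refine Finset.sum_le_sum fun i _ => ?_
          refine (variance_le_expectation_sq
            (measurable_of_finite (Z i)).aestronglyMeasurable).trans ?_
          simp only [Pi.pow_apply]
          rw [integral_ofVec]
          simp only [hZ]
          split_ifs
          · calc ∑ z, q i z * (Pi.single z 1 : Fin d → ℝ) y ^ 2 ≤ ∑ z, q i z * 1 := by
                  refine Finset.sum_le_sum fun z _ =>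
                    mul_le_mul_of_nonneg_left ?_ ((hq i).1 z)
                  rw [Pi.single_apply]
                  split_ifs <;> norm_num
              _ = 1 := by simp [(hq i).2]
          · simp
      _ = k := by rw [sum_fin_ite_lt hkN fun _ => 1]; simp
  have hpt : ∀ x, |avg (unitVec (extendPath x₀ x)) k y - avg q k y|
      ≤ (S x - k * avg q k y) ^ 2 * (1 / (2 * k * √k)) + 1 / (2 * √k) := by
    intro x
    set a := avg (unitVec (extendPath x₀ x)) k y - avg q k y with ha
    have h1 : S x - k * avg q k y = k * a := by rw [hSx, ha]; ring
    rw [h1]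
    have h2 : (k * a) ^ 2 * (1 / (2 * k * √k)) + 1 / (2 * √k) = (k * a ^ 2 + 1) / (2 * √k) := by
      field_simp
    rw [h2, le_div_iff₀ (by positivity)]
    have h3 : (√(k : ℝ) * |a| - 1) ^ 2 = k * a ^ 2 - 2 * (√k * |a|) + 1 := by
      have : |a| ^ 2 = a ^ 2 := sq_abs a
      rw [sub_sq, mul_pow, this, Real.sq_sqrt hk'.le]
      ring
    have h4 := sq_nonneg (√(k : ℝ) * |a| - 1)
    rw [h3] at h4
    linarith
  calc _ ≤ ∫ x, ((S x - k * avg q k y) ^ 2 * (1 / (2 * k * √k)) + 1 / (2 * √k))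
          ∂(indepLaw q hq N) :=
        integral_mono Integrable.of_finite Integrable.of_finite hpt
    _ = (∫ x, (S x - k * avg q k y) ^ 2 ∂(indepLaw q hq N)) * (1 / (2 * k * √k))
          + 1 / (2 * √k) := by
        rw [integral_add Integrable.of_finite Integrable.of_finite, integral_mul_const]
        simp
    _ ≤ k * (1 / (2 * k * √k)) + 1 / (2 * √k) := by gcongr
    _ = 1 / √k := by field_simp; norm_num

end Independent

/-! ### The lower bound -/

section LowerBound

variable {A : Matrix (Fin d) (Fin d) ℝ} {δ : ℝ} {x₀ : Fin d} {q : ℕ → Fin d → ℝ}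

/-- The log-likelihood ratio of independent draws with respect to the reinforced chain. -/
def logRatio (A : Matrix (Fin d) (Fin d) ℝ) (q : ℕ → Fin d → ℝ) (n : ℕ) (x : ℕ → Fin d) : ℝ :=
  ∑ k ∈ Finset.range (n + 1), Real.log (q k (x k))
    - ∑ j ∈ Finset.range n, Real.log ((avg (unitVec x) (j + 1) ᵥ* A) (x (j + 1)))

lemma pathProb_nonneg (hA : IsStochasticGe A δ) (x : ℕ → Fin d) (n : ℕ) :
    0 ≤ pathProb A x₀ x n := by
  refine mul_nonneg (by split_ifs <;> norm_num) (Finset.prod_nonneg fun k _ => ?_)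
  exact (hA.vecMul_pos (avg_mem_stdSimplex (unitVec_mem_stdSimplex x) k.succ_pos) _).le

lemma prod_mul_exp_neg_logRatio_le (hA : IsStochasticGe A δ)
    (hq : ∀ k, q k ∈ stdSimplex ℝ (Fin d)) (hq0 : q 0 = Pi.single x₀ 1) (n : ℕ) (x : ℕ → Fin d) :
    (∏ k : Fin (n + 1), q k (x k)) * Real.exp (-logRatio A q n x) ≤ pathProb A x₀ x n := by
  rw [← Finset.prod_range fun k => q k (x k)]
  by_cases h : ∀ k ∈ Finset.range (n + 1), 0 < q k (x k)
  · have hx0 : x 0 = x₀ := by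
      have := h 0 (by simp)
      rw [hq0, Pi.single_apply] at this
      by_contra hne
      rw [if_neg hne] at this
      exact lt_irrefl _ this
    have h1 : ∏ k ∈ Finset.range (n + 1), q k (x k)
        = Real.exp (∑ k ∈ Finset.range (n + 1), Real.log (q k (x k))) := by
      rw [Real.exp_sum]
      exact Finset.prod_congr rfl fun k hk => (Real.exp_log (h k hk)).symm
    have h2 : pathProb A x₀ x n = Real.exp (∑ j ∈ Finset.range n,
        Real.log ((avg (unitVec x) (j + 1) ᵥ* A) (x (j + 1)))) := by
      rw [Real.exp_sum, pathProb, if_pos hx0, one_mul]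
      exact Finset.prod_congr rfl fun k _ => (Real.exp_log (hA.vecMul_pos
        (avg_mem_stdSimplex (unitVec_mem_stdSimplex x) k.succ_pos) _)).symm
    rw [h1, h2, ← Real.exp_add, logRatio]
    refine le_of_eq (congrArg _ ?_)
    ring
  · push Not at h
    obtain ⟨k, hk, hk0⟩ := h
    rw [Finset.prod_eq_zero hk (le_antisymm hk0 ((hq k).1 _)), zero_mul]
    exact pathProb_nonneg hA x n

lemma integral_logRatio_le (hA : IsStochasticGe A δ) (hq : ∀ k, q k ∈ stdSimplex ℝ (Fin d))
    (hq0 : q 0 = Pi.single x₀ 1) (n : ℕ) :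
    ∫ x, logRatio A q n (extendPath x₀ x) ∂(indepLaw q hq (n + 1))
      ≤ seqCost A n q + δ⁻¹ * d * ∑ j ∈ Finset.range n, 1 / √((j + 1 : ℕ) : ℝ) := by
  set Q := indepLaw q hq (n + 1) with hQ
  have h1 : ∀ k < n + 1, ∫ x, Real.log (q k (extendPath x₀ x k)) ∂Q
      = ∑ y, q k y * Real.log (q k y) := by
    intro k hk
    rw [← integral_indepLaw_apply hq (⟨k, hk⟩ : Fin (n + 1)) fun y => Real.log (q k y)]
    simp only [extendPath_of_lt x₀ _ hk, hQ]
  have h2 : ∀ j < n, ∫ x, Real.log ((avg (unitVec (extendPath x₀ x)) (j + 1) ᵥ* A)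
        (extendPath x₀ x (j + 1))) ∂Q
      ≥ ∑ y, q (j + 1) y * Real.log ((avg q (j + 1) ᵥ* A) y)
        - δ⁻¹ * d * (1 / √((j + 1 : ℕ) : ℝ)) := by
    intro j hj
    have hj' : j + 1 < n + 1 := by omega
    have h3 : ∫ x, Real.log ((avg q (j + 1) ᵥ* A) (extendPath x₀ x (j + 1))) ∂Q
        = ∑ y, q (j + 1) y * Real.log ((avg q (j + 1) ᵥ* A) y) := by
      rw [← integral_indepLaw_apply hq (⟨j + 1, hj'⟩ : Fin (n + 1))
        fun y => Real.log ((avg q (j + 1) ᵥ* A) y)]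
      simp only [extendPath_of_lt x₀ _ hj', hQ]
    have h4 : ∫ x, δ⁻¹ * ∑ y, |avg (unitVec (extendPath x₀ x)) (j + 1) y - avg q (j + 1) y| ∂Q
        ≤ δ⁻¹ * d * (1 / √((j + 1 : ℕ) : ℝ)) := by
      rw [integral_const_mul, integral_finsetSum _ fun y _ => Integrable.of_finite, mul_assoc]
      refine mul_le_mul_of_nonneg_left ?_ (inv_pos.2 hA.pos).le
      refine (Finset.sum_le_sum fun y _ =>
        integral_abs_avg_sub_le hq j.succ_pos hj'.le x₀ y).trans (le_of_eq ?_)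
      simp
    have h5 : ∫ x, (Real.log ((avg q (j + 1) ᵥ* A) (extendPath x₀ x (j + 1)))
          - δ⁻¹ * ∑ y, |avg (unitVec (extendPath x₀ x)) (j + 1) y - avg q (j + 1) y|) ∂Q
        ≤ ∫ x, Real.log ((avg (unitVec (extendPath x₀ x)) (j + 1) ᵥ* A)
          (extendPath x₀ x (j + 1))) ∂Q := by
      refine integral_mono Integrable.of_finite Integrable.of_finite fun x => ?_
      have := hA.log_vecMul_sub_le (avg_mem_stdSimplex hq j.succ_pos)
        (avg_mem_stdSimplex (unitVec_mem_stdSimplex (extendPath x₀ x)) j.succ_pos)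
        (extendPath x₀ x (j + 1))
      simp only [abs_sub_comm (avg q _ _), Nat.succ_eq_add_one] at this
      linarith
    rw [integral_sub Integrable.of_finite Integrable.of_finite, h3] at h5
    linarith
  simp only [logRatio]
  rw [integral_sub Integrable.of_finite Integrable.of_finite,
    integral_finsetSum _ fun _ _ => Integrable.of_finite,
    integral_finsetSum _ fun _ _ => Integrable.of_finite,
    Finset.sum_congr rfl fun k hk => h1 k (Finset.mem_range.1 hk), Finset.sum_range_succ']
  have h6 : ∑ y, q 0 y * Real.log (q 0 y) = 0 := by
    simp [hq0, Pi.single_apply]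
  have h7 := Finset.sum_le_sum fun j hj => h2 j (Finset.mem_range.1 hj)
  rw [Finset.sum_sub_distrib, ← Finset.mul_sum] at h7
  simp only [seqCost, relEnt, Finset.sum_sub_distrib]
  linarith

variable {Ω : Type*} [MeasurableSpace Ω] {P : Measure Ω} {X : ℕ → Ω → Fin d}

/-- Change of measure: the chain charges every set charged by independent draws. -/
lemma IsReinforcedChain.mul_exp_le_measureReal_mem [IsProbabilityMeasure P]
    (hA : IsStochasticGe A δ) (hX : IsReinforcedChain P A x₀ X)
    (hq : ∀ k, q k ∈ stdSimplex ℝ (Fin d)) (hq0 : q 0 = Pi.single x₀ 1) (n : ℕ)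
    (G : Set (ProbabilityMeasure (Fin d))) {b K : ℝ} (hb0 : 0 < b)
    (hb : b ≤ (indepLaw q hq (n + 1)).real
      {x | empiricalMeasure (extendPath x₀ x) n ∈ G})
    (hK : ∫ x, logRatio A q n (extendPath x₀ x) ∂(indepLaw q hq (n + 1)) ≤ K) (hK0 : 0 ≤ K) :
    b * Real.exp (-((K + 1) / b)) ≤ P.real {ω | empiricalMeasure (fun i => X i ω) n ∈ G} := by
  classical
  set w : (Fin (n + 1) → Fin d) → ℝ := fun x => ∏ k : Fin (n + 1), q k (x k) with hw
  set l : (Fin (n + 1) → Fin d) → ℝ := fun x => logRatio A q n (extendPath x₀ x) with hl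
  set p : (Fin (n + 1) → Fin d) → ℝ := fun x => pathProb A x₀ (extendPath x₀ x) n with hp
  have hw0 : ∀ x, 0 ≤ w x := fun x => Finset.prod_nonneg fun k _ => (hq k).1 _
  have hwp : ∀ x, w x * Real.exp (-l x) ≤ p x := by
    intro x
    have := prod_mul_exp_neg_logRatio_le hA hq hq0 n (extendPath x₀ x)
    have h1 : ∏ k : Fin (n + 1), q k (extendPath x₀ x k) = w x :=
      Finset.prod_congr rfl fun k _ => by rw [extendPath_of_lt x₀ x k.2]
    rwa [h1] at this
  set g : Finset (Fin (n + 1) → Fin d) :=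
    Finset.univ.filter fun x => empiricalMeasure (extendPath x₀ x) n ∈ G with hg
  have hpG : P.real {ω | empiricalMeasure (fun i => X i ω) n ∈ G} = ∑ x ∈ g, p x :=
    hX.measureReal_empiricalMeasure_mem hA n G
  have hpc : ∑ x ∈ gᶜ, p x ≤ 1 := by
    have h1 : ∑ x, p x = 1 := by
      have := hX.measureReal_empiricalMeasure_mem hA n univ
      simpa using this.symm
    rw [← h1]
    exact Finset.sum_le_sum_of_subset_of_nonneg (Finset.subset_univ _)
      fun x _ _ => pathProb_nonneg hA _ n
  have hbw : b ≤ ∑ x ∈ g, w x := by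
    refine hb.trans (le_of_eq ?_)
    have h1 : {x : Fin (n + 1) → Fin d | empiricalMeasure (extendPath x₀ x) n ∈ G}
        = (g : Set (Fin (n + 1) → Fin d)) := by ext; simp [hg]
    rw [h1, ← sum_measureReal_singleton]
    exact Finset.sum_congr rfl fun x _ => indepLaw_real_singleton hq x
  have hKw : ∑ x ∈ g, w x * l x + ∑ x ∈ gᶜ, w x * l x ≤ K := by
    rw [Finset.sum_add_sum_compl, ← integral_indepLaw hq l]
    exact hK
  have hlc : -1 ≤ ∑ x ∈ gᶜ, w x * l x := by
    have h1 : ∑ x ∈ gᶜ, -(w x * l x) ≤ ∑ x ∈ gᶜ, p x := by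
      refine Finset.sum_le_sum fun x _ => le_trans ?_ (hwp x)
      have := Real.add_one_le_exp (-l x)
      nlinarith [hw0 x]
    rw [Finset.sum_neg_distrib] at h1
    linarith
  set t := (K + 1) / b with ht
  have ht0 : 0 ≤ t := by positivity
  have hbt : b * t = K + 1 := by rw [ht]; field_simp
  have hpt : ∀ x, Real.exp (-t) * (w x * (1 + t) - w x * l x) ≤ p x := by
    intro x
    refine le_trans ?_ (hwp x)
    have h1 := Real.add_one_le_exp (t - l x)
    have h2 : Real.exp (-l x) = Real.exp (-t) * Real.exp (t - l x) := by
      rw [← Real.exp_add]; congr 1; ring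
    rw [h2]
    have h3 := mul_le_mul_of_nonneg_left h1 (mul_nonneg (Real.exp_pos (-t)).le (hw0 x))
    linarith
  rw [hpG]
  calc b * Real.exp (-t) = Real.exp (-t) * (b * (1 + t) - (K + 1)) := by rw [← hbt]; ring
    _ ≤ Real.exp (-t) * (∑ x ∈ g, w x * (1 + t) - ∑ x ∈ g, w x * l x) := by
        refine mul_le_mul_of_nonneg_left ?_ (Real.exp_pos _).le
        rw [← Finset.sum_mul]
        have := mul_le_mul_of_nonneg_right hbw (show 0 ≤ 1 + t by linarith)
        linarith
    _ = ∑ x ∈ g, Real.exp (-t) * (w x * (1 + t) - w x * l x) := by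
        rw [← Finset.sum_sub_distrib, Finset.mul_sum]
    _ ≤ ∑ x ∈ g, p x := Finset.sum_le_sum fun x _ => hpt x

lemma exists_ball_subset {G : Set (ProbabilityMeasure (Fin d))} (hG : IsOpen G)
    {m : ProbabilityMeasure (Fin d)} (hm : m ∈ G) :
    ∃ ε > 0, ∀ m' : ProbabilityMeasure (Fin d), ∑ y, |mass m' y - mass m y| < ε → m' ∈ G := by
  obtain ⟨U, hU, rfl⟩ := isClosedEmbedding_mass.isInducing.isOpen_iff.1 hG
  obtain ⟨ε, hε, hball⟩ := Metric.isOpen_iff.1 hU _ hm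
  refine ⟨ε, hε, fun m' hm' => hball ?_⟩
  rw [Metric.mem_ball, dist_pi_lt_iff hε]
  intro y
  rw [Real.dist_eq]
  exact (Finset.single_le_sum (f := fun y => |mass m' y - mass m y|)
    (fun _ _ => abs_nonneg _) (Finset.mem_univ y)).trans_lt hm'

lemma le_indepLaw_real_mem (hq : ∀ k, q k ∈ stdSimplex ℝ (Fin d)) (x₀ : Fin d) (n : ℕ)
    {G : Set (ProbabilityMeasure (Fin d))} {m : ProbabilityMeasure (Fin d)} {ε D : ℝ} (hε : 0 < ε)
    (hG : ∀ m' : ProbabilityMeasure (Fin d), ∑ y, |mass m' y - mass m y| < ε → m' ∈ G)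
    (hD : ∑ y, |avg q (n + 1) y - mass m y| ≤ D) :
    1 - (d * (1 / √((n + 1 : ℕ) : ℝ)) + D) / ε ≤ (indepLaw q hq (n + 1)).real
      {x | empiricalMeasure (extendPath x₀ x) n ∈ G} := by
  set Q := indepLaw q hq (n + 1) with hQ
  set S := {x : Fin (n + 1) → Fin d | empiricalMeasure (extendPath x₀ x) n ∈ G} with hS
  have hSm : MeasurableSet S := S.toFinite.measurableSet
  set f : (Fin (n + 1) → Fin d) → ℝ :=
    fun x => ∑ y, |avg (unitVec (extendPath x₀ x)) (n + 1) y - avg q (n + 1) y| with hf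
  have hpt : ∀ x, 1 - (f x + D) / ε ≤ S.indicator (fun _ => (1 : ℝ)) x := by
    intro x
    by_cases hx : x ∈ S
    · rw [indicator_of_mem hx]
      have h1 : 0 ≤ f x := Finset.sum_nonneg fun _ _ => abs_nonneg _
      have h2 : 0 ≤ D := (Finset.sum_nonneg fun _ _ => abs_nonneg _).trans hD
      have : 0 ≤ (f x + D) / ε := by positivity
      linarith
    · rw [indicator_of_notMem hx, sub_nonpos, one_le_div hε]
      by_contra hlt
      push Not at hlt
      refine hx (hG _ ?_)
      rw [mass_empiricalMeasure]
      refine lt_of_le_of_lt ?_ hlt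
      refine le_trans ?_ (add_le_add_right hD _)
      rw [hf, ← Finset.sum_add_distrib]
      exact Finset.sum_le_sum fun y _ => abs_sub_le _ _ _
  have hint := integral_mono (μ := Q) Integrable.of_finite Integrable.of_finite hpt
  rw [integral_indicator_const _ hSm, smul_eq_mul, mul_one,
    integral_sub Integrable.of_finite Integrable.of_finite, integral_div,
    integral_add Integrable.of_finite Integrable.of_finite] at hint
  simp only [integral_const, probReal_univ, one_smul] at hint
  refine le_trans ?_ hint
  have hfi : ∫ x, f x ∂Q ≤ d * (1 / √((n + 1 : ℕ) : ℝ)) := by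
    rw [hf, integral_finsetSum _ fun y _ => Integrable.of_finite]
    refine (Finset.sum_le_sum fun y _ =>
      integral_abs_avg_sub_le hq n.succ_pos le_rfl x₀ y).trans (le_of_eq ?_)
    simp
  gcongr

lemma sum_abs_avg_update_sub_le {β : ℕ → Fin d → ℝ} (hβ : ∀ j, β j ∈ stdSimplex ℝ (Fin d))
    {v : Fin d → ℝ} (hv : v ∈ stdSimplex ℝ (Fin d)) (n : ℕ) :
    ∑ y, |avg (Function.update β 0 v) (n + 1) y - avg β (n + 1) y| ≤ 2 / ((n + 1 : ℕ) : ℝ) := by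
  have hn : (0 : ℝ) < ((n + 1 : ℕ) : ℝ) := by positivity
  have h1 : ∀ y, avg (Function.update β 0 v) (n + 1) y - avg β (n + 1) y
      = (v y - β 0 y) / ((n + 1 : ℕ) : ℝ) := by
    intro y
    simp only [avg]
    rw [Finset.sum_range_succ', Finset.sum_range_succ' (fun i => β i y)]
    simp only [Function.update_self, ne_eq, Nat.add_eq_zero_iff, one_ne_zero, and_false,
      not_false_eq_true, Function.update_of_ne]
    field_simp
    ring
  simp only [h1, abs_div, abs_of_pos hn]
  rw [← Finset.sum_div, div_le_div_iff_of_pos_right hn]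
  exact sum_abs_sub_le_two hv (hβ 0)

lemma seqCost_update_le (hA : IsStochasticGe A δ) {β : ℕ → Fin d → ℝ}
    (hβ : ∀ j, β j ∈ stdSimplex ℝ (Fin d)) {v : Fin d → ℝ} (hv : v ∈ stdSimplex ℝ (Fin d))
    (hq : ∀ j, Function.update β 0 v j ∈ stdSimplex ℝ (Fin d)) (n : ℕ) :
    seqCost A n (Function.update β 0 v) ≤ seqCost A n β + δ⁻¹ * harmonicSum n := by
  rw [seqCost, seqCost, harmonicSum, Finset.mul_sum, ← Finset.sum_add_distrib]
  refine Finset.sum_le_sum fun j _ => ?_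
  rw [Function.update_of_ne (Nat.succ_ne_zero j)]
  refine (relEnt_vecMul_le_add hA (hβ _) (avg_mem_stdSimplex hq j.succ_pos)
    (avg_mem_stdSimplex hβ j.succ_pos)).trans ?_
  gcongr
  · exact (inv_pos.2 hA.pos).le
  · exact sum_abs_avg_update_sub_le hβ hv j

lemma IsReinforcedChain.exists_le_measureReal_mem [IsProbabilityMeasure P]
    (hA : IsStochasticGe A δ) (hX : IsReinforcedChain P A x₀ X)
    {G : Set (ProbabilityMeasure (Fin d))} {m : ProbabilityMeasure (Fin d)} {ε : ℝ} (hε : 0 < ε)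
    (hG : ∀ m' : ProbabilityMeasure (Fin d), ∑ y, |mass m' y - mass m y| < ε → m' ∈ G)
    {c : ℝ} (hc0 : 0 ≤ c) (hc : rate A m < ENNReal.ofReal c) (n : ℕ) {b : ℝ} (hb0 : 0 < b)
    (hb : b ≤ 1 - (d * (1 / √((n + 1 : ℕ) : ℝ)) + 2 / ((n + 1 : ℕ) : ℝ)) / ε) :
    b * Real.exp (-(((n + 1) * c + 2 * (δ⁻¹ * harmonicSum n)
        + δ⁻¹ * d * (∑ j ∈ Finset.range n, 1 / √((j + 1 : ℕ) : ℝ)) + 1) / b))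
      ≤ P.real {ω | empiricalMeasure (fun i => X i ω) n ∈ G} := by
  obtain ⟨β, hβ, hβm, hβc⟩ := exists_seq_of_rate_lt hA hc n
  have hv : (Pi.single x₀ 1 : Fin d → ℝ) ∈ stdSimplex ℝ (Fin d) := single_mem_stdSimplex ℝ x₀
  set q := Function.update β 0 (Pi.single x₀ 1 : Fin d → ℝ) with hqdef
  have hq : ∀ j, q j ∈ stdSimplex ℝ (Fin d) := by
    intro j
    rcases eq_or_ne j 0 with rfl | hj
    · rw [hqdef, Function.update_self]; exact hv
    · rw [hqdef, Function.update_of_ne hj]; exact hβ j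
  have hq0 : q 0 = Pi.single x₀ 1 := Function.update_self _ _ _
  refine hX.mul_exp_le_measureReal_mem hA hq hq0 n G hb0
    (hb.trans (le_indepLaw_real_mem hq x₀ n hε hG ?_)) ?_ ?_
  · rw [← hβm]
    exact sum_abs_avg_update_sub_le hβ hv n
  · have h1 := integral_logRatio_le hA hq hq0 n
    have h2 := seqCost_update_le hA hβ hv hq n
    linarith
  · have h1 := harmonicSum_nonneg n
    have h2 := (inv_pos.2 hA.pos).le
    positivity

lemma IsReinforcedChain.neg_le_liminf [IsProbabilityMeasure P] (hA : IsStochasticGe A δ)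
    (hX : IsReinforcedChain P A x₀ X) {G : Set (ProbabilityMeasure (Fin d))} (hG : IsOpen G)
    {m : ProbabilityMeasure (Fin d)} (hm : m ∈ G) {c : ℝ} (hc0 : 0 ≤ c)
    (hc : rate A m < ENNReal.ofReal c) :
    ((-c : ℝ) : EReal) ≤ liminf (fun n : ℕ =>
      ENNReal.log (P {ω | empiricalMeasure (fun i => X i ω) n ∈ G}) / (n : EReal)) atTop := by
  obtain ⟨ε, hε, hball⟩ := exists_ball_subset hG hm
  have hsqrt : Tendsto (fun n : ℕ => 1 / √((n + 1 : ℕ) : ℝ)) atTop (𝓝 0) := by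
    simp only [one_div]
    exact tendsto_inv_atTop_zero.comp (Real.tendsto_sqrt_atTop.comp
      (tendsto_natCast_atTop_atTop.comp (tendsto_add_atTop_nat 1)))
  have hinv : Tendsto (fun n : ℕ => 2 / ((n + 1 : ℕ) : ℝ)) atTop (𝓝 0) :=
    (tendsto_const_div_atTop_nhds_zero_nat (2 : ℝ)).comp (tendsto_add_atTop_nat 1)
  set b : ℕ → ℝ := fun n => 1 - (d * (1 / √((n + 1 : ℕ) : ℝ)) + 2 / ((n + 1 : ℕ) : ℝ)) / ε with hb
  have hblim : Tendsto b atTop (𝓝 1) := by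
    have := (((hsqrt.const_mul (d : ℝ)).add hinv).div_const ε).const_sub 1
    simpa only [mul_zero, add_zero, zero_div, sub_zero] using this
  set K : ℕ → ℝ := fun n => (n + 1) * c + 2 * (δ⁻¹ * harmonicSum n)
        + δ⁻¹ * d * (∑ j ∈ Finset.range n, 1 / √((j + 1 : ℕ) : ℝ)) + 1 with hK
  have hKlim : Tendsto (fun n : ℕ => K n / ((n : ℝ) + 1)) atTop (𝓝 c) := by
    have h1 := (((tendsto_harmonicSum_div.const_mul (2 * δ⁻¹)).add
      ((tendsto_sum_div_add_one hsqrt).const_mul (δ⁻¹ * d))).add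
      (tendsto_one_div_add_atTop_nhds_zero_nat (𝕜 := ℝ))).const_add c
    simp only [mul_zero, add_zero] at h1
    refine h1.congr fun n => ?_
    have : (n : ℝ) + 1 ≠ 0 := by positivity
    simp only [hK]
    field_simp
    ring
  have hratio : Tendsto (fun n : ℕ => ((n : ℝ) + 1) / n) atTop (𝓝 1) := by
    have h1 := (tendsto_one_div_atTop_nhds_zero_nat (𝕜 := ℝ)).const_add 1
    rw [add_zero] at h1
    refine h1.congr' ?_
    filter_upwards [eventually_ge_atTop 1] with n hn
    have : (n : ℝ) ≠ 0 := by positivity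
    field_simp
  have hlim : Tendsto (fun n : ℕ => ((Real.log (b n) / n
      - K n / ((n : ℝ) + 1) * (((n : ℝ) + 1) / n) / b n : ℝ) : EReal)) atTop
      (𝓝 ((-c : ℝ) : EReal)) := by
    refine (continuous_coe_real_ereal.tendsto _).comp ?_
    have h1 : Tendsto (fun n : ℕ => Real.log (b n) / n) atTop (𝓝 0) :=
      (hblim.log one_ne_zero).div_atTop tendsto_natCast_atTop_atTop
    have h2 := h1.sub ((hKlim.mul hratio).div hblim one_ne_zero)
    simpa using h2
  rw [← hlim.liminf_eq]
  refine liminf_le_liminf ?_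
  filter_upwards [eventually_ge_atTop 1, hblim.eventually_const_lt one_pos] with n hn hbn
  have hn0 : (n : ℝ) ≠ 0 := by positivity
  have h1 := hX.exists_le_measureReal_mem hA hε hball hc0 hc n hbn le_rfl
  have h2 : ENNReal.ofReal (Real.exp (Real.log (b n) - K n / b n))
      ≤ P {ω | empiricalMeasure (fun i => X i ω) n ∈ G} := by
    rw [← ofReal_measureReal]
    refine ENNReal.ofReal_le_ofReal (le_trans (le_of_eq ?_) h1)
    rw [sub_eq_add_neg, Real.exp_add, Real.exp_log hbn]
  have h3 := ENNReal.log_monotone h2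
  rw [ENNReal.log_ofReal_of_pos (Real.exp_pos _), Real.log_exp] at h3
  calc ((Real.log (b n) / n - K n / ((n : ℝ) + 1) * (((n : ℝ) + 1) / n) / b n : ℝ) : EReal)
      = (((Real.log (b n) - K n / b n) / n : ℝ) : EReal) := by
        congr 1
        field_simp
    _ = ((Real.log (b n) - K n / b n : ℝ) : EReal) / ((n : ℝ) : EReal) := EReal.coe_div _ _
    _ ≤ _ := EReal.div_le_div_right_of_nonneg (by positivity) h3

lemma IsReinforcedChain.le_liminf [IsProbabilityMeasure P] (hA : IsStochasticGe A δ)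
    (hX : IsReinforcedChain P A x₀ X) {G : Set (ProbabilityMeasure (Fin d))} (hG : IsOpen G) :
    -((⨅ m ∈ G, rate A m : ℝ≥0∞) : EReal) ≤ liminf (fun n : ℕ =>
      ENNReal.log (P {ω | empiricalMeasure (fun i => X i ω) n ∈ G}) / (n : EReal)) atTop := by
  rw [EReal.neg_le]
  refine EReal.le_of_forall_lt_iff_le.1 fun z hz => ?_
  have hz0 : 0 ≤ z := by
    exact_mod_cast (EReal.coe_ennreal_nonneg _).trans hz.le
  have hz' : ⨅ m ∈ G, rate A m < ENNReal.ofReal z := by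
    rw [← EReal.coe_ennreal_lt_coe_ennreal_iff, EReal.coe_ennreal_ofReal, max_eq_left hz0]
    exact hz
  simp only [iInf_lt_iff] at hz'
  obtain ⟨m, hm, hmz⟩ := hz'
  rw [EReal.neg_le, ← EReal.coe_neg]
  exact hX.neg_le_liminf hA hG hm hz0 hmz

end LowerBound

end ReinforcedChain

end

open ReinforcedChain in
theorem theorem1 {d : ℕ} (A : Matrix (Fin d) (Fin d) ℝ)
    (hA : A ∈ Matrix.rowStochastic ℝ (Fin d)) (hpos : ∀ x y, 0 < A x y) (x₀ : Fin d)
    {Ω : Type*} [MeasurableSpace Ω] (P : Measure Ω) [IsProbabilityMeasure P]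
    (X : ℕ → Ω → Fin d) (hX : IsReinforcedChain P A x₀ X) :
    (∀ m, rate A m ≠ ∞) ∧ IsRateFunction (rate A) ∧
      SatisfiesLDP P (fun n ω => empiricalMeasure (fun i => X i ω) n) (rate A) := by
  obtain ⟨δ, hδ⟩ := exists_isStochasticGe hA hpos
  exact ⟨rate_ne_top hδ, isRateFunction_rate hδ, fun F _ => hX.limsup_le hδ F,
    fun G hG => hX.le_liminf hδ hG⟩
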